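/- **Theorem 3.2 (Labeling Error Rate).** *Setting.* Let $p^*\in[0,1]^n$ and $y^*\in\{0,1\}^m$. The answers $X_{ij}\in\{0,1\}$ ($i\in[n]$, $j\in[m]$) are independent, with $\mathbb{P}(X_{ij}=y^*_j)=p^*_i$ (one-coin Dawid–Skene model). For $p\in[0,1]^n$, $y\in[0,1]^m$ put $$F(p,y)=\sum_{i,j}y_j\big(X_{ij}\log p_i+(1-X_{ij})\log(1-p_i)\big)+\sum_{i,j}(1-y_j)\big(X_{ij}\log(1-p_i)+(1-X_{ij})\log p_i\big)+\sum_j\Big(y_j\log\tfrac1{y_j}+(1-y_j)\log\tfrac1{1-y_j}\Big),$$ with $\log 0=-\infty$, $0\cdot(-\infty)=0$ and $0\log\frac10=0$. Let $\mu_i=\max(p_i^*,1-p_i^*)$, $\bar\mu=\frac1n\sum_i\mu_i$, $\bar\nu=\frac1n\sum_i(2\mu_i-1)^2$, and $D(a\|b)=a\log\frac ab+(1-a)\log\frac{1-a}{1-b}$. *Claim.* There are absolute constants $C'>0$ and $N\in\mathbb{N}$ such that for all $n,m\ge N$ with $n\le m\le e^n$, all $p^*\in[0,1]^n$ and all $y^*\in\{0,1\}^m$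 satisfying $$\frac1n\sum_i p_i^*>\frac12+2\sqrt{\frac{\log m}{nm}}\qquad\text{and}\qquad \bar\nu\ge\frac{\max\big(4[\log m+\log n],\,12\log n\big)}{n},$$ the following holds. With probability at least $1-C'/m$, every $\hat y$ that belongs to a global maximizer $(\hat p,\hat y)$ of $F$ over $\{(p,y)\in[0,1]^n\times[0,1]^m:\frac1n\sum_i p_i>\frac12\}$ satisfies $$\frac1m\sum_j|\hat y_j-y^*_j|\le\exp\Big(-\frac18 n\bar\nu\Big).$$ If additionally $\bar\mu<1$ and $\bar\nu>\frac1n\log\frac{4}{1-\bar\mu}$, then with probability at least $1-C'/m$ every such $\hat y$ satisfies $$\frac1m\sum_j|\hat y_j-y^*_j|\le\exp\Big(-\frac18 n\max\Big\{\bar\nu,\frac13D(\bar\mu\|1-\bar\mu)\Big\}\Big).$$ -/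

import Mathlib

namespace DawidSkene

/-- The numerical value in `{0, 1}` of a binary label. -/
def label (b : Bool) : ℝ := if b then 1 else 0

/-- Data distribution of the one-coin Dawid-Skene model with workers' abilities `p` and ground
truth `y`: the answers `X i j` are independent over all pairs (worker `i`, item `j`), and worker
`i` labels item `j` correctly with probability `p i`. -/
structure IsOneCoinModel {Ω : Type*} [MeasurableSpace Ω] (P : MeasureTheory.Measure Ω) {n m : ℕ}
    (p : Fin n → ℝ) (y : Fin m → Bool) (X : Fin n → Fin m → Ω → Bool) : Prop where
  measurable : ∀ i j, Measurable (X i j)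
  indep : ProbabilityTheory.iIndepFun (fun (ij : Fin n × Fin m) (ω : Ω) => X ij.1 ij.2 ω) P
  prob_correct : ∀ i j, P.real {ω | X i j ω = y j} = p i

/-- Effective ability `μ_i` of a worker of ability `p`. -/
noncomputable def effAbility (p : ℝ) : ℝ := if 1 / 2 ≤ p then p else 1 - p

/-- The average effective ability `μ̄`. -/
noncomputable def muBar {n : ℕ} (p : Fin n → ℝ) : ℝ := (∑ i, effAbility (p i)) / n

/-- The collective wisdom `ν̄`, the average of `(2 μ_i - 1) ^ 2`. -/
noncomputable def nuBar {n : ℕ} (p : Fin n → ℝ) : ℝ := (∑ i, (2 * effAbility (p i) - 1) ^ 2) / n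

/-- The Kullback-Leibler divergence `D(a‖b)` between Bernoulli laws (used for `a, b ∈ (0, 1)`). -/
noncomputable def klBernoulli (a b : ℝ) : ℝ :=
  a * Real.log (a / b) + (1 - a) * Real.log ((1 - a) / (1 - b))

/-- The logarithm of a number `x ≥ 0` with values in the extended reals, with `log 0 = -∞`. -/
noncomputable def elog (x : ℝ) : EReal := if 0 < x then (Real.log x : EReal) else ⊥

/-- The Dawid-Skene objective `F(p, y)` for the answers `x`, with the conventions `log 0 = -∞` and
`0 * (-∞) = 0` (the latter is the convention of `EReal`). The last term is the entropy
`∑ j, (y_j log (1 / y_j) + (1 - y_j) log (1 / (1 - y_j)))`. -/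
noncomputable def objective {n m : ℕ} (x : Fin n → Fin m → Bool)
    (p : Fin n → ℝ) (y : Fin m → ℝ) : EReal :=
  (∑ i, ∑ j, (y j : EReal) *
      ((label (x i j) : EReal) * elog (p i) + ((1 - label (x i j) : ℝ) : EReal) * elog (1 - p i)))
  + (∑ i, ∑ j, ((1 - y j : ℝ) : EReal) *
      ((label (x i j) : EReal) * elog (1 - p i) + ((1 - label (x i j) : ℝ) : EReal) * elog (p i)))
  + ((∑ j, Real.binEntropy (y j) : ℝ) : EReal)

/-- The feasible pairs `(p, y) ∈ [0, 1]^n × [0, 1]^m` with `(1 / n) ∑ i, p_i > 1 / 2`. -/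
def feasible (n m : ℕ) : Set ((Fin n → ℝ) × (Fin m → ℝ)) :=
  {q | (∀ i, q.1 i ∈ Set.Icc (0 : ℝ) 1) ∧ (∀ j, q.2 j ∈ Set.Icc (0 : ℝ) 1) ∧
    1 / 2 < (∑ i, q.1 i) / n}

/-- `yHat` is the label part of a global maximizer `(pHat, yHat)` of the constrained program
`max {F(p, y) : (1 / n) ∑ i, p_i > 1 / 2}` for the answers `x`. -/
def IsConstrainedEstimator {n m : ℕ} (x : Fin n → Fin m → Bool) (yHat : Fin m → ℝ) : Prop :=
  ∃ pHat : Fin n → ℝ, (pHat, yHat) ∈ feasible n m ∧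
    IsMaxOn (fun q : (Fin n → ℝ) × (Fin m → ℝ) => objective x q.1 q.2) (feasible n m) (pHat, yHat)

/-- The labeling error `(1 / m) ∑ j, |ŷ_j - y*_j|`. -/
noncomputable def labelingError {m : ℕ} (yHat : Fin m → ℝ) (yStar : Fin m → Bool) : ℝ :=
  (∑ j, |yHat j - label (yStar j)|) / m

end DawidSkene

/-!
The objective is eliminated in favour of the labels. Since the constraint `∑ i, p i > n / 2` is
strict, the abilities at a constrained maximizer are the agreements of the workers with the labels,
and since swapping the two labels leaves the objective unchanged, the labels `yHat` maximize the
resulting function over the whole cube (`IsConstrainedEstimator.isPotentialMax`). In terms of the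
label errors `e j = |yHat j - yStar j|` and of the matrix `z` of correctness of the answers (reversed
for workers of ability below `1 / 2`, so that worker `i` errs with probability `q i ≤ 1 / 2`), this
function is
`potential z e = ∑ j, H (e j) - m * ∑ i, H (b i + (1 / m) * ∑ j, e j * s i j)`,
where `H` is the binary entropy, `b i` the fraction of wrong answers of worker `i` and `s i j = ±1`.

Let `K = ∑ i, (1 - 2 * q i) ^ 2` and let `ē` be the mean of the `e j`.

* Comparing a maximizer with `e = 0` shows that `ē` is close to `0` or to `1`
  (`IsPotentialMax.mean_dichotomy`). The only probabilistic input is that the centered answers act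
  like a matrix of norm `O(√m)` (`SpreadDeviations`), which is a union bound over the `2 ^ m` sets of
  items. Maximizers with `ē` near `1` are images under the label swap of ones near `0`, and the
  constraint excludes them.
* Near `0` the same comparison is expanded to first order in `e`; the coefficient of `e j` is the log
  likelihood ratio `v` of item `j` under the estimated abilities, and the entropy of a label error
  `t` is at most `t * v - t + exp (1 - v / 2)` (`add_binEntropy_sub_mul_le`). This gives the
  self-bounding estimate `ē ≤ C * M` (`IsPotentialMax.mean_le`), where `M` is the average over the
  items `j` of products `∏ i, φ i (b i) (z i j)` of square roots of likelihood ratios. For workers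
  with small error probability the expansion is replaced by chords of the entropy, because its
  derivative is unbounded.
* `M` has a small mean. Its factors belong to independent workers, and the answers of one worker are
  exchangeable: given `b i`, an answer is wrong with probability exactly `b i`, so that the dependence
  of the estimated abilities on the item under consideration does no harm
  (`sum_rowWeight_mul_wrongFrac`). Jensen's inequality gives the factor `2 * √(q i * (1 - q i))`, hence
  the mean `exp (-K / 2)`, and Markov's inequality the rate `exp (-K / 8)` with failure probability
  `O(exp (-K / 4)) = O(1 / m)`.
* If a third of the divergence exceeds the collective wisdom, the average error probability `a` is
  below `1 / 14`. The estimate is applied a second time with the bound `ē ≤ exp (-K / 8)` at hand; the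
  mean of `M` is now at most about `(exp 1 * √a) ^ n` (`prod_meanErrFactor_le`, `exponent_le`).
-/

namespace DawidSkene
open Real Finset MeasureTheory ProbabilityTheory

/-! ### Inequalities for the binary entropy -/

theorem binEntropy_eq (p : ℝ) : binEntropy p = -(p * log p) - (1 - p) * log (1 - p) := by
  simp only [binEntropy, log_inv]; ring

/-- Gibbs' inequality for Bernoulli laws. -/
theorem binEntropy_le_crossEntropy {a c : ℝ} (ha : a ∈ Set.Icc (0 : ℝ) 1) (hc0 : 0 < c)
    (hc1 : c < 1) : binEntropy a ≤ -(a * log c) - (1 - a) * log (1 - c) := by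
  have key : ∀ x y : ℝ, 0 ≤ x → 0 < y → -(x * log x) ≤ -(x * log y) + (y - x) := by
    intro x y hx hy
    rcases hx.eq_or_lt with rfl | hx
    · simpa using hy.le
    · have h := log_le_sub_one_of_pos (div_pos hy hx)
      rw [log_div hy.ne' hx.ne'] at h
      have h2 := mul_le_mul_of_nonneg_left h hx.le
      have h3 : x * (y / x - 1) = y - x := by field_simp
      linarith
  rw [binEntropy_eq]
  have h1 := key a c ha.1 hc0
  have h2 := key (1 - a) (1 - c) (by linarith [ha.2]) (by linarith)
  linarith

/-- The quadratic lower bound comes from bounding the Kullback-Leibler divergence of two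
Bernoulli laws by their chi-square divergence. -/
theorem binEntropy_ge_tangent_sub_sq {a b : ℝ} (ha : a ∈ Set.Icc (0 : ℝ) 1) (hb0 : 0 < b)
    (hb1 : b < 1) :
    binEntropy b + (a - b) * log ((1 - b) / b) - (a - b) ^ 2 / (b * (1 - b)) ≤ binEntropy a := by
  have key : ∀ x y : ℝ, 0 ≤ x → 0 < y → x * log x ≤ x * log y + x * (x / y - 1) := by
    intro x y hx hy
    rcases hx.eq_or_lt with rfl | hx
    · simp
    · have h := log_le_sub_one_of_pos (div_pos hx hy)
      rw [log_div hx.ne' hy.ne'] at h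
      have h2 := mul_le_mul_of_nonneg_left h hx.le
      linarith
  have hb1' : 0 < 1 - b := by linarith
  rw [binEntropy_eq, binEntropy_eq, log_div hb1'.ne' hb0.ne']
  have h1 := key a b ha.1 hb0
  have h2 := key (1 - a) (1 - b) (by linarith [ha.2]) hb1'
  have h3 : a * (a / b - 1) + (1 - a) * ((1 - a) / (1 - b) - 1) = (a - b) ^ 2 / (b * (1 - b)) := by
    field_simp; ring
  linarith

/-- The slope of the entropy on `[a, c]` is at least its slope at any `x ≥ c`. -/
theorem binEntropy_sub_ge {a c x : ℝ} (ha : 0 ≤ a) (hac : a ≤ c) (hcx : c ≤ x) (hx : x < 1) :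
    (c - a) * log ((1 - x) / x) ≤ binEntropy c - binEntropy a := by
  rcases (ha.trans hac).eq_or_lt with rfl | hc
  · obtain rfl : a = 0 := le_antisymm hac ha
    simp
  have hx0 : 0 < x := hc.trans_le hcx
  have h1 := binEntropy_le_crossEntropy (a := a) ⟨ha, by linarith⟩ hc (by linarith)
  have h2 : log ((1 - x) / x) ≤ log ((1 - c) / c) := by
    apply log_le_log (div_pos (by linarith) hx0)
    rw [div_le_div_iff₀ hx0 hc]; nlinarith
  rw [binEntropy_eq c]
  rw [log_div (by linarith) hc.ne'] at h2
  nlinarith [mul_le_mul_of_nonneg_left h2 (sub_nonneg.2 hac)]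

theorem neg_mul_log_one_sub_le {p : ℝ} (hp1 : p ≤ 1) : -((1 - p) * log (1 - p)) ≤ p := by
  rcases hp1.eq_or_lt with rfl | h
  · simp
  have h' : 0 < 1 - p := by linarith
  have h1 := log_le_sub_one_of_pos (inv_pos.2 h')
  rw [log_inv] at h1
  have h2 := mul_le_mul_of_nonneg_left h1 h'.le
  have h3 : (1 - p) * ((1 - p)⁻¹ - 1) = p := by field_simp; ring
  linarith

theorem binEntropy_le_neg_mul_log_add {p : ℝ} (hp1 : p ≤ 1) :
    binEntropy p ≤ -(p * log p) + p := by
  rw [binEntropy_eq]; linarith [neg_mul_log_one_sub_le hp1]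

/-- A chord from the origin bounds the loss of entropy when the argument decreases, with a slope
that is finite even where the derivative of the entropy at the new argument is not. -/
theorem binEntropy_sub_le_mul {b u : ℝ} (hb0 : 0 < b) (hb1 : b ≤ 1) (hu0 : 0 ≤ u) (hub : u ≤ b) :
    binEntropy b - binEntropy (b - u) ≤ u * (log (1 / b) + 1) := by
  have hu1 : 0 ≤ 1 - u / b := by rw [sub_nonneg]; exact (div_le_one hb0).2 hub
  have hconc := strictConcave_binEntropy.concaveOn.2 (show b ∈ Set.Icc (0 : ℝ) 1 from ⟨hb0.le, hb1⟩)
    (show (0 : ℝ) ∈ Set.Icc (0 : ℝ) 1 by simp) hu1 (div_nonneg hu0 hb0.le) (by ring)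
  simp only [smul_eq_mul, binEntropy_zero, mul_zero, add_zero] at hconc
  have e1 : (1 - u / b) * b = b - u := by field_simp
  rw [e1] at hconc
  have h2 := binEntropy_le_neg_mul_log_add hb1
  have h3 := mul_le_mul_of_nonneg_left h2 (div_nonneg hu0 hb0.le)
  have h4 : u / b * (-(b * log b) + b) = u * (log (1 / b) + 1) := by
    rw [one_div, log_inv]; field_simp
  linarith

/-- Entropy increment for an argument that gains `r` and loses `u`. -/
theorem binEntropy_add_sub_ge {b r u x : ℝ} (hb0 : 0 ≤ b) (hr : 0 ≤ r) (hu0 : 0 ≤ u) (hub : u ≤ b)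
    (hx : b + r ≤ x) (hx1 : x < 1) :
    r * log ((1 - x) / x) - u * (log (1 / b) + 1) ≤ binEntropy (b + r - u) - binEntropy b := by
  have h1 := binEntropy_sub_ge (a := b - u) (c := b + r - u) (x := x) (by linarith) (by linarith)
    (by linarith) hx1
  have e : b + r - u - (b - u) = r := by ring
  rw [e] at h1
  rcases hb0.eq_or_lt with rfl | hb
  · obtain rfl : u = 0 := le_antisymm hub hu0
    simp only [sub_zero] at *
    linarith
  · have h2 := binEntropy_sub_le_mul hb (by linarith) hu0 hub
    linarith

/-- The soft-assignment bound: the entropy gain of a label error `t` does not compensate a log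
likelihood ratio `v` unless `exp (-v / 2)` is large. -/
theorem add_binEntropy_sub_mul_le {t v : ℝ} (ht : t ∈ Set.Icc (0 : ℝ) 1) :
    t + binEntropy t - t * v ≤ exp (1 - v / 2) := by
  have hsplit : exp (1 - v / 2) = exp 1 * exp (-v / 2) := by rw [← exp_add]; ring_nf
  rcases le_or_gt 0 v with hv | hv
  · -- maximize `t * (2 - v - log t)` over all `t > 0`
    have h1 := binEntropy_le_neg_mul_log_add ht.2
    have h2 : t * (2 - v - log t) ≤ exp (1 - v) := by
      rcases ht.1.eq_or_lt with h0 | h0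
      · rw [← h0]; simpa using (exp_pos _).le
      · have h3 := add_one_le_exp (1 - v - log t)
        have h4 : exp (1 - v - log t) = exp (1 - v) / t := by rw [exp_sub, exp_log h0]
        rw [h4, le_div_iff₀ h0] at h3
        nlinarith
    have h3 : exp (1 - v) ≤ exp (1 - v / 2) := exp_le_exp.2 (by linarith)
    nlinarith
  · have h1 : binEntropy t ≤ 1 := binEntropy_le_log_two.trans (by linarith [log_two_lt_d9])
    have h2 := add_one_le_exp (-v / 2)
    have h3 : (2 : ℝ) ≤ exp 1 := by linarith [add_one_le_exp (1 : ℝ)]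
    have h4 : 2 * exp (-v / 2) ≤ exp 1 * exp (-v / 2) :=
      mul_le_mul_of_nonneg_right h3 (exp_pos _).le
    nlinarith [ht.1, ht.2]

/-- The entropy deficit of the Bernoulli law with mean `(1 + x) / 2`. -/
noncomputable def entropyGap (x : ℝ) : ℝ := log 2 - binEntropy ((1 + x) / 2)

theorem entropyGap_neg (x : ℝ) : entropyGap (-x) = entropyGap x := by
  unfold entropyGap
  rw [← binEntropy_one_sub]
  congr 2; ring

theorem entropyGap_zero : entropyGap 0 = 0 := by
  unfold entropyGap
  norm_num [← one_div]
  rw [one_div, binEntropy_two_inv, sub_self]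

theorem entropyGap_nonneg (x : ℝ) : 0 ≤ entropyGap x := sub_nonneg.2 binEntropy_le_log_two

theorem entropyGap_le_sq {x : ℝ} (hx : |x| ≤ 1) : entropyGap x ≤ x ^ 2 := by
  obtain ⟨h1, h2⟩ := abs_le.1 hx
  have h := binEntropy_ge_tangent_sub_sq (a := (1 + x) / 2) (b := 2⁻¹)
    ⟨by linarith, by linarith⟩ (by norm_num) (by norm_num)
  have e : ((1 - 2⁻¹ : ℝ) / 2⁻¹) = 1 := by norm_num
  rw [e, log_one, binEntropy_two_inv] at h
  unfold entropyGap
  have e2 : ((1 + x) / 2 - 2⁻¹) ^ 2 / (2⁻¹ * (1 - 2⁻¹) : ℝ) = x ^ 2 := by ring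
  linarith

/-- The Kullback-Leibler divergence is at least twice a squared Hellinger distance. -/
theorem sq_div_four_le_entropyGap {x : ℝ} (hx : |x| ≤ 1) : x ^ 2 / 4 ≤ entropyGap x := by
  obtain ⟨h1, h2⟩ := abs_le.1 hx
  have key : ∀ b : ℝ, 0 ≤ b → b - √b ≤ b / 2 * (log 2 + log (b / 2)) := by
    intro b hb
    rcases hb.eq_or_lt with rfl | hb
    · simp
    have hs : 0 < √b := sqrt_pos.2 hb
    have h := log_le_sub_one_of_pos (inv_pos.2 hs)
    rw [log_inv, log_sqrt hb.le] at h
    have e : log 2 + log (b / 2) = log b := by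
      rw [← log_mul (by norm_num) (by positivity)]; congr 1; ring
    rw [e]
    have h3 := mul_le_mul_of_nonneg_left h hb.le
    have h4 : b * (√b)⁻¹ = √b := by
      rw [← div_eq_mul_inv]; exact div_sqrt
    nlinarith
  have k1 := key (1 + x) (by linarith)
  have k2 := key (1 - x) (by linarith)
  have hs : √(1 + x) + √(1 - x) ≤ 2 - x ^ 2 / 4 := by
    have hx2 : x ^ 2 ≤ 1 := by nlinarith
    refine le_of_sq_le_sq ?_ (by linarith)
    have e1 : √(1 + x) ^ 2 = 1 + x := sq_sqrt (by linarith)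
    have e2 : √(1 - x) ^ 2 = 1 - x := sq_sqrt (by linarith)
    have e3 : √(1 + x) * √(1 - x) ≤ 1 - x ^ 2 / 2 := by
      rw [← sqrt_mul (by linarith)]
      rw [sqrt_le_left (by linarith)]
      nlinarith [sq_nonneg (x ^ 2)]
    nlinarith [sq_nonneg (x ^ 2)]
  unfold entropyGap
  rw [binEntropy_eq]
  have e : (1 - (1 + x) / 2) = (1 - x) / 2 := by ring
  rw [e]
  nlinarith

theorem convexOn_entropyGap : ConvexOn ℝ (Set.Icc (-1) 1) entropyGap := by
  have h := (strictConcave_binEntropy.concaveOn)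
  refine ⟨convex_Icc _ _, fun x hx y hy a b ha hb hab => ?_⟩
  have h' := h.2 (x := (1 + x) / 2) (y := (1 + y) / 2) ⟨by linarith [hx.1], by linarith [hx.2]⟩
    ⟨by linarith [hy.1], by linarith [hy.2]⟩ ha hb hab
  simp only [smul_eq_mul] at h' ⊢
  have e : a * ((1 + x) / 2) + b * ((1 + y) / 2) = (1 + (a * x + b * y)) / 2 := by
    rw [show a = 1 - b by linarith]; ring
  rw [e] at h'
  unfold entropyGap
  have : a * log 2 + b * log 2 = log 2 := by rw [← add_mul, hab, one_mul]
  nlinarith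

/-- Contracting by `c` and perturbing by `z` shrinks the entropy gap by the factor `|c|`, up to a
quadratic term in the perturbation. -/
theorem entropyGap_contract_add {c s z η : ℝ} (hη0 : 0 < η) (hη1 : η < 1) (hc : |c| ≤ 1 - η)
    (hs : |s| ≤ 1) (hcs : |c * s + z| ≤ 1) :
    entropyGap (c * s + z) ≤ |c| * entropyGap s + z ^ 2 / η ^ 2 := by
  rcases le_or_gt |z| η with hz | hz
  · have hη' : 0 < 1 - η := by linarith
    -- `c * s + z = |c| * (±s) + η * (z / η) + (1 - η - |c|) * 0`
    have hc0 := abs_nonneg c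
    obtain ⟨s', hs', hgap, hcs'⟩ : ∃ s', |s'| ≤ 1 ∧ entropyGap s' = entropyGap s ∧
        c * s = |c| * s' := by
      rcases abs_cases c with h | h
      · exact ⟨s, hs, rfl, by rw [h.1]⟩
      · exact ⟨-s, by rwa [abs_neg], entropyGap_neg s, by rw [h.1]; ring⟩
    have hzη : |z / η| ≤ 1 := by rw [abs_div, abs_of_pos hη0]; exact (div_le_one hη0).2 hz
    have hr0 : 0 ≤ |c| / (1 - η) := by positivity
    have hr1 : |c| / (1 - η) ≤ 1 := (div_le_one hη').2 hc
    have hin := abs_le.1 hs'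
    have h1 := convexOn_entropyGap.2 (x := s') (y := 0) ⟨hin.1, hin.2⟩ (by norm_num)
      hr0 (sub_nonneg.2 hr1) (by ring)
    simp only [smul_eq_mul, mul_zero, add_zero, entropyGap_zero] at h1
    have hmem : |c| / (1 - η) * s' ∈ Set.Icc (-1 : ℝ) 1 := by
      rw [Set.mem_Icc, ← abs_le, abs_mul, abs_of_nonneg hr0]
      exact mul_le_one₀ hr1 (abs_nonneg _) hs'
    have hin2 := abs_le.1 hzη
    have h2 := convexOn_entropyGap.2 (y := z / η) hmem ⟨hin2.1, hin2.2⟩ hη'.le hη0.le (by ring)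
    simp only [smul_eq_mul] at h2
    have e : (1 - η) * (|c| / (1 - η) * s') + η * (z / η) = c * s + z := by
      rw [hcs']; field_simp
    rw [e] at h2
    have h3 := entropyGap_le_sq hzη
    have h4 : (1 - η) * entropyGap (|c| / (1 - η) * s') ≤ |c| * entropyGap s := by
      have := mul_le_mul_of_nonneg_left h1 hη'.le
      rw [hgap] at this
      have e : (1 - η) * (|c| / (1 - η) * entropyGap s) = |c| * entropyGap s := by field_simp
      linarith
    have h5 : η * entropyGap (z / η) ≤ z ^ 2 / η ^ 2 := by
      rw [div_pow] at h3
      have : 0 ≤ z ^ 2 / η ^ 2 := by positivity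
      nlinarith [entropyGap_nonneg (z / η)]
    linarith
  · have h1 : 1 ≤ z ^ 2 / η ^ 2 := by
      rw [le_div_iff₀ (by positivity), one_mul, ← sq_abs z]
      exact pow_le_pow_left₀ hη0.le hz.le 2
    have h2 := entropyGap_le_sq hcs
    have h3 : (c * s + z) ^ 2 ≤ 1 := by rw [← sq_abs]; exact pow_le_one₀ (abs_nonneg _) hcs
    have h4 := mul_nonneg (abs_nonneg c) (entropyGap_nonneg s)
    linarith

/-! ### The finite probability space of correctness matrices -/

/-- Law of a single answer that is wrong with probability `q`; `true` stands for a correct one. -/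
def answerWeight (q : ℝ) (b : Bool) : ℝ := if b then 1 - q else q

/-- Law of the answers of one worker, who errs independently with probability `q`. -/
def rowWeight {m : ℕ} (q : ℝ) (r : Fin m → Bool) : ℝ := ∏ j, answerWeight q (r j)

/-- Law of the matrix of correctness indicators of workers with error probabilities `q`. -/
def matrixWeight {n m : ℕ} (q : Fin n → ℝ) (z : Fin n → Fin m → Bool) : ℝ :=
  ∏ i, rowWeight (q i) (z i)

/-- The value `1` of a correct and `-1` of a wrong answer. -/
def sgn (b : Bool) : ℝ := if b then 1 else -1

/-- The fraction of wrong answers of a worker. -/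
noncomputable def wrongFrac {m : ℕ} (r : Fin m → Bool) : ℝ := (∑ j, if r j then (0 : ℝ) else 1) / m

section Weights

variable {n m : ℕ} {q : ℝ}

theorem answerWeight_nonneg (hq : q ∈ Set.Icc (0 : ℝ) 1) (b : Bool) : 0 ≤ answerWeight q b := by
  unfold answerWeight; split_ifs <;> linarith [hq.1, hq.2]

theorem sum_answerWeight_mul (q : ℝ) (h : Bool → ℝ) :
    ∑ b, answerWeight q b * h b = (1 - q) * h true + q * h false := by
  simp [answerWeight]

theorem rowWeight_nonneg (hq : q ∈ Set.Icc (0 : ℝ) 1) (r : Fin m → Bool) : 0 ≤ rowWeight q r :=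
  prod_nonneg fun _ _ => answerWeight_nonneg hq _

theorem matrixWeight_nonneg {q : Fin n → ℝ} (hq : ∀ i, q i ∈ Set.Icc (0 : ℝ) 1)
    (z : Fin n → Fin m → Bool) : 0 ≤ matrixWeight q z :=
  prod_nonneg fun i _ => rowWeight_nonneg (hq i) _

theorem sum_rowWeight_mul_prod (q : ℝ) (h : Fin m → Bool → ℝ) :
    ∑ r, rowWeight q r * ∏ j, h j (r j) = ∏ j, ((1 - q) * h j true + q * h j false) := by
  simp_rw [← sum_answerWeight_mul, prod_univ_sum, rowWeight, ← prod_mul_distrib,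
    Fintype.piFinset_univ]

theorem sum_matrixWeight_mul_prod (q : Fin n → ℝ) (f : Fin n → (Fin m → Bool) → ℝ) :
    ∑ z, matrixWeight q z * ∏ i, f i (z i) = ∏ i, ∑ r, rowWeight (q i) r * f i r := by
  simp_rw [prod_univ_sum, matrixWeight, ← prod_mul_distrib, Fintype.piFinset_univ]

theorem sum_rowWeight (q : ℝ) : ∑ r : Fin m → Bool, rowWeight q r = 1 := by
  simpa using sum_rowWeight_mul_prod (m := m) q (fun _ _ => 1)

theorem sum_matrixWeight_mul_row (q : Fin n → ℝ) (i : Fin n) (f : (Fin m → Bool) → ℝ) :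
    ∑ z, matrixWeight q z * f (z i) = ∑ r, rowWeight (q i) r * f r := by
  have h := sum_matrixWeight_mul_prod q (fun i' r => if i' = i then f r else 1)
  have e1 : ∀ z : Fin n → Fin m → Bool, ∏ i', (if i' = i then f (z i') else 1) = f (z i) :=
    fun z => by simp
  simp_rw [e1] at h
  rw [h, Finset.prod_eq_single i]
  · simp
  · intro b _ hb; simp [hb, sum_rowWeight]
  · simp

/-- Probability of a set of matrices of correctness indicators. -/
noncomputable def matrixProb (q : Fin n → ℝ) (A : Set (Fin n → Fin m → Bool)) : ℝ :=
  ∑ z, A.indicator (matrixWeight q) z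

theorem matrixProb_mono {q : Fin n → ℝ} (hq : ∀ i, q i ∈ Set.Icc (0 : ℝ) 1)
    {A B : Set (Fin n → Fin m → Bool)} (h : A ⊆ B) : matrixProb q A ≤ matrixProb q B :=
  sum_le_sum fun z _ => Set.indicator_le_indicator_of_subset h (matrixWeight_nonneg hq) z

theorem matrixProb_union_le {q : Fin n → ℝ} (hq : ∀ i, q i ∈ Set.Icc (0 : ℝ) 1)
    (A B : Set (Fin n → Fin m → Bool)) :
    matrixProb q (A ∪ B) ≤ matrixProb q A + matrixProb q B := by
  classical
  unfold matrixProb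
  rw [← sum_add_distrib]
  refine sum_le_sum fun z _ => ?_
  have := matrixWeight_nonneg hq z
  simp only [Set.indicator_apply, Set.mem_union]
  split_ifs <;> first | linarith | tauto

theorem matrixProb_iUnion_le {q : Fin n → ℝ} (hq : ∀ i, q i ∈ Set.Icc (0 : ℝ) 1) {ι : Type*}
    [Fintype ι] (A : ι → Set (Fin n → Fin m → Bool)) :
    matrixProb q (⋃ k, A k) ≤ ∑ k, matrixProb q (A k) := by
  classical
  unfold matrixProb
  rw [sum_comm]
  refine sum_le_sum fun z _ => ?_
  have h0 : ∀ k ∈ univ, 0 ≤ (A k).indicator (matrixWeight q) z :=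
    fun k _ => Set.indicator_nonneg (fun z _ => matrixWeight_nonneg hq z) z
  by_cases h : z ∈ ⋃ k, A k
  · obtain ⟨k, hk⟩ := Set.mem_iUnion.1 h
    rw [Set.indicator_of_mem h, ← Set.indicator_of_mem hk (matrixWeight q)]
    exact single_le_sum h0 (mem_univ k)
  · rw [Set.indicator_of_notMem h]
    exact sum_nonneg h0

/-- Markov's inequality. -/
theorem matrixProb_le_div {q : Fin n → ℝ} (hq : ∀ i, q i ∈ Set.Icc (0 : ℝ) 1)
    {f : (Fin n → Fin m → Bool) → ℝ} (hf : ∀ z, 0 ≤ f z) {t c : ℝ} (ht : 0 < t)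
    (hc : ∑ z, matrixWeight q z * f z ≤ c) {A : Set (Fin n → Fin m → Bool)}
    (hA : ∀ z ∈ A, t ≤ f z) : matrixProb q A ≤ c / t := by
  classical
  rw [le_div_iff₀ ht]
  refine le_trans ?_ hc
  unfold matrixProb
  rw [sum_mul]
  refine sum_le_sum fun z _ => ?_
  have hw := matrixWeight_nonneg hq z
  by_cases h : z ∈ A
  · rw [Set.indicator_of_mem h]; exact mul_le_mul_of_nonneg_left (hA z h) hw
  · rw [Set.indicator_of_notMem h, zero_mul]; exact mul_nonneg hw (hf z)

theorem wrongFrac_mem (r : Fin m → Bool) : wrongFrac r ∈ Set.Icc (0 : ℝ) 1 := by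
  unfold wrongFrac
  refine ⟨div_nonneg (sum_nonneg fun j _ => by split_ifs <;> norm_num) (by positivity), ?_⟩
  apply div_le_one_of_le₀ _ (by positivity)
  calc _ ≤ ∑ j : Fin m, (1 : ℝ) := sum_le_sum fun j _ => by split_ifs <;> norm_num
    _ = m := by simp

/-- The entries of a row are exchangeable, so conditionally on the fraction of wrong answers a
given answer is wrong with probability equal to this fraction. -/
theorem sum_rowWeight_mul_wrongFrac (hm : 0 < m) (q : ℝ) (φ : ℝ → Bool → ℝ) (j : Fin m) :
    ∑ r, rowWeight q r * φ (wrongFrac r) (r j) = ∑ r : Fin m → Bool, rowWeight q r *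
      ((1 - wrongFrac r) * φ (wrongFrac r) true + wrongFrac r * φ (wrongFrac r) false) := by
  have hm' : (m : ℝ) ≠ 0 := by positivity
  have hswap : ∀ k : Fin m, ∑ r, rowWeight q r * φ (wrongFrac r) (r k) =
      ∑ r, rowWeight q r * φ (wrongFrac r) (r j) := by
    intro k
    let σ := Equiv.swap j k
    rw [← Equiv.sum_comp (Equiv.arrowCongr σ (Equiv.refl Bool))]
    refine sum_congr rfl fun r _ => ?_
    have e0 : ∀ l, (Equiv.arrowCongr σ (Equiv.refl Bool)) r l = r (σ.symm l) := fun l => rfl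
    have e1 : rowWeight q (Equiv.arrowCongr σ (Equiv.refl Bool) r) = rowWeight q r := by
      unfold rowWeight
      simp_rw [e0]
      exact Equiv.prod_comp σ.symm fun l => answerWeight q (r l)
    have e2 : wrongFrac (Equiv.arrowCongr σ (Equiv.refl Bool) r) = wrongFrac r := by
      unfold wrongFrac
      simp_rw [e0]
      rw [Equiv.sum_comp σ.symm fun l => if r l then (0 : ℝ) else 1]
    rw [e1, e2, e0]
    simp [σ]
  have havg : ∀ r : Fin m → Bool, (1 - wrongFrac r) * φ (wrongFrac r) true +
      wrongFrac r * φ (wrongFrac r) false = (∑ k, φ (wrongFrac r) (r k)) / m := by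
    intro r
    have e : ∀ k, φ (wrongFrac r) (r k) = (1 - (if r k then (0 : ℝ) else 1)) * φ (wrongFrac r) true
        + (if r k then (0 : ℝ) else 1) * φ (wrongFrac r) false := by
      intro k; cases r k <;> simp
    rw [sum_congr rfl fun k _ => e k, sum_add_distrib, ← sum_mul, ← sum_mul, sum_sub_distrib]
    have : ∑ k, (if r k then (0 : ℝ) else 1) = wrongFrac r * m := by
      unfold wrongFrac; field_simp
    rw [this]
    simp
    field_simp
  simp_rw [havg, mul_div_assoc', ← sum_div, mul_sum]
  rw [sum_comm, sum_congr rfl fun k _ => hswap k]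
  simp
  field_simp

theorem sum_rowWeight_mul_wrong (q : ℝ) (j : Fin m) :
    ∑ r, rowWeight q r * (if r j then (0 : ℝ) else 1) = q := by
  have h := sum_rowWeight_mul_prod (m := m) q
    (fun k b => if k = j then (if b then (0 : ℝ) else 1) else 1)
  simp only [prod_ite_eq', mem_univ, if_true] at h
  rw [h, Finset.prod_eq_single j] <;> simp +contextual

theorem sum_rowWeight_mul_wrongFrac_self (hm : 0 < m) (q : ℝ) :
    ∑ r : Fin m → Bool, rowWeight q r * wrongFrac r = q := by
  have h := sum_rowWeight_mul_wrongFrac hm q (fun _ b => if b then (0 : ℝ) else 1) ⟨0, hm⟩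
  rw [sum_rowWeight_mul_wrong] at h
  simpa using h.symm

/-- Jensen's inequality for the square root. -/
theorem sum_rowWeight_mul_sqrt_le (hq : q ∈ Set.Icc (0 : ℝ) 1) (f : (Fin m → Bool) → ℝ)
    (hf : ∀ r, 0 ≤ f r) :
    ∑ r, rowWeight q r * √(f r) ≤ √(∑ r, rowWeight q r * f r) := by
  have := Real.strictConcaveOn_sqrt.concaveOn.le_map_sum (t := univ) (w := rowWeight q) (p := f)
    (fun r _ => rowWeight_nonneg hq r) (sum_rowWeight q) (fun r _ => hf r)
  simpa using this

end Weights

/-- Bound for the square root of the likelihood ratio of the labels "wrong" and "correct" that is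
contributed by a worker of error probability `q` with a fraction `b` of wrong answers, if the
answer in question is `c`. For workers with small `q` it depends on an a priori bound `ρ` of the
average label error. -/
noncomputable def errFactor (ρ q b : ℝ) (c : Bool) : ℝ :=
  if q < 1 / 25 then (if c then 103 / 100 * √(b + ρ) else √(exp 1 / b))
  else (if c then √(b / (1 - b)) else √((1 - b) / b))

theorem errFactor_nonneg (ρ q b : ℝ) (c : Bool) : 0 ≤ errFactor ρ q b c := by
  unfold errFactor; split_ifs <;> positivity

/-- The mean of `errFactor` for a single answer. -/
noncomputable def meanErrFactor (ρ q : ℝ) : ℝ :=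
  if q < 1 / 25 then exp 1 * √(q + ρ) else 2 * √(q * (1 - q))

theorem mul_sqrt_div_self {x y : ℝ} (hx : 0 ≤ x) : x * √(y / x) = √(x * y) := by
  rcases hx.eq_or_lt with rfl | hx
  · simp
  · nth_rewrite 1 [← sqrt_sq hx.le]
    rw [← sqrt_mul (by positivity)]
    congr 1; field_simp

theorem sqrt_exp_one_lt : √(exp 1) < 1649 / 1000 := by
  rw [sqrt_lt' (by norm_num)]
  linarith [exp_one_lt_d9]

theorem sum_rowWeight_mul_errFactor_le {m : ℕ} (hm : 0 < m) {q ρ : ℝ}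
    (hq : q ∈ Set.Icc (0 : ℝ) 1) (hρ : 0 ≤ ρ) (j : Fin m) :
    ∑ r, rowWeight q r * errFactor ρ q (wrongFrac r) (r j) ≤ meanErrFactor ρ q := by
  rw [sum_rowWeight_mul_wrongFrac hm q (errFactor ρ q) j]
  have hmean := sum_rowWeight_mul_wrongFrac_self hm q
  by_cases h : q < 1 / 25 <;>
    simp only [errFactor, meanErrFactor, h, if_true, if_false, Bool.false_eq_true]
  · have hle : ∀ r : Fin m → Bool, rowWeight q r * ((1 - wrongFrac r) *
        (103 / 100 * √(wrongFrac r + ρ)) + wrongFrac r * √(exp 1 / wrongFrac r)) ≤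
        103 / 100 * (rowWeight q r * √(wrongFrac r + ρ)) +
          √(exp 1) * (rowWeight q r * √(wrongFrac r)) := by
      intro r
      have hb := wrongFrac_mem r
      rw [mul_sqrt_div_self hb.1, mul_comm (wrongFrac r) (exp 1), sqrt_mul (exp_pos _).le]
      have h1 : (1 - wrongFrac r) * (103 / 100 * √(wrongFrac r + ρ)) ≤
          103 / 100 * √(wrongFrac r + ρ) := by
        have := sqrt_nonneg (wrongFrac r + ρ)
        nlinarith [mul_nonneg hb.1 this]
      nlinarith [mul_le_mul_of_nonneg_left h1 (rowWeight_nonneg hq r)]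
    refine (sum_le_sum fun r _ => hle r).trans ?_
    rw [sum_add_distrib, ← mul_sum, ← mul_sum]
    have h1 := sum_rowWeight_mul_sqrt_le (m := m) hq (fun r => wrongFrac r + ρ)
      (fun r => add_nonneg (wrongFrac_mem r).1 hρ)
    have h2 := sum_rowWeight_mul_sqrt_le (m := m) hq (fun r => wrongFrac r)
      (fun r => (wrongFrac_mem r).1)
    simp_rw [mul_add, sum_add_distrib, ← sum_mul, hmean, sum_rowWeight, one_mul] at h1
    rw [hmean] at h2
    have h3 : √q ≤ √(q + ρ) := sqrt_le_sqrt (by linarith)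
    have h4 := sqrt_exp_one_lt
    have h5 := exp_one_gt_d9
    have h6 := sqrt_nonneg (exp 1)
    nlinarith [sqrt_nonneg (q + ρ)]
  · have hle : ∀ r : Fin m → Bool, rowWeight q r * ((1 - wrongFrac r) *
        √(wrongFrac r / (1 - wrongFrac r)) + wrongFrac r * √((1 - wrongFrac r) / wrongFrac r)) =
        2 * (rowWeight q r * √(wrongFrac r * (1 - wrongFrac r))) := by
      intro r
      have hb := wrongFrac_mem r
      rw [mul_sqrt_div_self hb.1, mul_sqrt_div_self (by linarith [hb.2]),
        mul_comm (1 - wrongFrac r) (wrongFrac r)]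
      ring
    rw [sum_congr rfl fun r _ => hle r, ← mul_sum]
    have h1 := sum_rowWeight_mul_sqrt_le (m := m) hq (fun r => wrongFrac r * (1 - wrongFrac r))
      (fun r => mul_nonneg (wrongFrac_mem r).1 (by linarith [(wrongFrac_mem r).2]))
    have h2 : ∑ r : Fin m → Bool, rowWeight q r * (wrongFrac r * (1 - wrongFrac r)) ≤
        q * (1 - q) := by
      calc _ ≤ ∑ r : Fin m → Bool, (q ^ 2 * rowWeight q r +
            (1 - 2 * q) * (rowWeight q r * wrongFrac r)) := sum_le_sum fun r _ => by
              nlinarith [mul_nonneg (rowWeight_nonneg hq r) (sq_nonneg (wrongFrac r - q))]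
        _ = _ := by rw [sum_add_distrib, ← mul_sum, ← mul_sum, hmean, sum_rowWeight]; ring
    have h3 := sqrt_le_sqrt h2
    linarith

/-- The average over the items of the product over the workers of `errFactor`. -/
noncomputable def avgErrFactor {n m : ℕ} (ρ : ℝ) (q : Fin n → ℝ) (z : Fin n → Fin m → Bool) : ℝ :=
  (∑ j, ∏ i, errFactor ρ (q i) (wrongFrac (z i)) (z i j)) / m

theorem avgErrFactor_nonneg {n m : ℕ} (ρ : ℝ) (q : Fin n → ℝ) (z : Fin n → Fin m → Bool) :
    0 ≤ avgErrFactor ρ q z :=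
  div_nonneg (sum_nonneg fun _ _ => prod_nonneg fun _ _ => errFactor_nonneg _ _ _ _)
    (by positivity)

theorem sum_matrixWeight_mul_avgErrFactor_le {n m : ℕ} (hm : 0 < m) {q : Fin n → ℝ} {ρ : ℝ}
    (hq : ∀ i, q i ∈ Set.Icc (0 : ℝ) 1) (hρ : 0 ≤ ρ) :
    ∑ z : Fin n → Fin m → Bool, matrixWeight q z * avgErrFactor ρ q z ≤
      ∏ i, meanErrFactor ρ (q i) := by
  have hm' : (0 : ℝ) < m := by positivity
  have h : ∀ j : Fin m, ∑ z : Fin n → Fin m → Bool, matrixWeight q z *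
      ∏ i, errFactor ρ (q i) (wrongFrac (z i)) (z i j) ≤ ∏ i, meanErrFactor ρ (q i) := by
    intro j
    rw [sum_matrixWeight_mul_prod q (fun i r => errFactor ρ (q i) (wrongFrac r) (r j))]
    exact prod_le_prod (fun i _ => sum_nonneg fun r _ => mul_nonneg (rowWeight_nonneg (hq i) r)
      (errFactor_nonneg _ _ _ _)) fun i _ => sum_rowWeight_mul_errFactor_le hm (hq i) hρ j
  simp_rw [avgErrFactor, mul_div_assoc', ← sum_div, mul_sum]
  rw [sum_comm, div_le_iff₀ hm']
  refine (sum_le_sum fun j _ => h j).trans ?_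
  simp [mul_comm]

/-! ### Concentration of the answers -/

/-- The centered indicator of a wrong answer. -/
def errDev (q : ℝ) (b : Bool) : ℝ := (if b then 0 else 1) - q

theorem sgn_eq (q : ℝ) (b : Bool) : sgn b = (1 - 2 * q) - 2 * errDev q b := by
  cases b <;> simp [sgn, errDev]; ring

theorem abs_sgn (b : Bool) : |sgn b| = 1 := by cases b <;> simp [sgn]

theorem wrongFrac_sub {m : ℕ} (hm : 0 < m) (q : ℝ) (r : Fin m → Bool) :
    wrongFrac r - q = (∑ j, errDev q (r j)) / m := by
  have hm' : (m : ℝ) ≠ 0 := by positivity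
  unfold wrongFrac errDev
  rw [sum_sub_distrib]
  simp
  field_simp

/-- Moment generating function of a centered Bernoulli variable, by symmetrization. -/
theorem mgf_errDev_le {q : ℝ} (hq : q ∈ Set.Icc (0 : ℝ) 1) (θ : ℝ) :
    (1 - q) * exp (θ * errDev q true) + q * exp (θ * errDev q false) ≤ exp (θ ^ 2 / 2) := by
  refine le_trans ?_ (cosh_le_exp_half_sq θ)
  have h1 : exp (-(θ * q)) ≤ (1 - q) + q * exp (-θ) := by
    have := convexOn_exp.2 (Set.mem_univ 0) (Set.mem_univ (-θ)) (sub_nonneg.2 hq.2) hq.1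
      (by ring)
    simp only [smul_eq_mul, mul_zero, zero_add, exp_zero, mul_one] at this
    rwa [show -(θ * q) = q * -θ by ring]
  have e1 : θ * errDev q true = -(θ * q) := by simp [errDev]
  have e2 : exp (θ * errDev q false) = exp (-(θ * q)) * exp θ := by
    rw [← exp_add]; simp [errDev]; ring
  rw [e1, e2]
  have h0 : 0 ≤ (1 - q) + q * exp θ := by nlinarith [exp_pos θ, hq.1, hq.2]
  calc _ = exp (-(θ * q)) * ((1 - q) + q * exp θ) := by ring
    _ ≤ ((1 - q) + q * exp (-θ)) * ((1 - q) + q * exp θ) := mul_le_mul_of_nonneg_right h1 h0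
    _ = 1 + 2 * (q * (1 - q)) * (cosh θ - 1) := by
        have : exp θ * exp (-θ) = 1 := by rw [← exp_add]; simp
        rw [cosh_eq]; linear_combination q ^ 2 * this
    _ ≤ cosh θ := by nlinarith [one_le_cosh θ, sq_nonneg (1 - 2 * q), hq.1, hq.2]

/-- A variable with the moment generating function bound of a centered Gaussian of variance `v`
has a square with exponential moments, by integrating the bound against a Gaussian density. -/
theorem sum_mul_exp_sq_le {ι : Type*} [Fintype ι] (w x : ι → ℝ) {v : ℝ} (hv : 0 < v)
    (h : ∀ θ : ℝ, ∑ i, w i * exp (θ * x i) ≤ exp (v * θ ^ 2 / 2)) :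
    ∑ i, w i * exp (x i ^ 2 / (4 * v)) ≤ √2 := by
  have hint : ∀ i, Integrable fun θ : ℝ => exp (-v * (θ - x i / (2 * v)) ^ 2) :=
    fun i => (integrable_exp_neg_mul_sq hv).comp_sub_right _
  have hval : ∀ i, ∫ θ : ℝ, exp (-v * (θ - x i / (2 * v)) ^ 2) = √(π / v) := by
    intro i
    rw [integral_sub_right_eq_self (fun θ : ℝ => exp (-v * θ ^ 2)), integral_gaussian]
  have hexp : ∀ i (θ : ℝ), exp (x i ^ 2 / (4 * v)) * exp (-v * (θ - x i / (2 * v)) ^ 2) =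
      exp (θ * x i) * exp (-v * θ ^ 2) := by
    intro i θ
    rw [← exp_add, ← exp_add]; congr 1; field_simp; ring
  have hle : ∫ θ : ℝ, ∑ i, w i * exp (x i ^ 2 / (4 * v)) * exp (-v * (θ - x i / (2 * v)) ^ 2) ≤
      ∫ θ : ℝ, exp (-(v / 2) * θ ^ 2) := by
    refine integral_mono (integrable_finsetSum _ fun i _ => (hint i).const_mul _)
      (integrable_exp_neg_mul_sq (half_pos hv)) fun θ => ?_
    have e : ∑ i, w i * exp (x i ^ 2 / (4 * v)) * exp (-v * (θ - x i / (2 * v)) ^ 2) =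
        (∑ i, w i * exp (θ * x i)) * exp (-v * θ ^ 2) := by
      rw [sum_mul]
      refine sum_congr rfl fun i _ => ?_
      rw [mul_assoc, hexp, mul_assoc]
    simp only [e]
    refine (mul_le_mul_of_nonneg_right (h θ) (exp_pos _).le).trans_eq ?_
    rw [← exp_add]; congr 1; ring
  rw [integral_finsetSum _ fun i _ => (hint i).const_mul _, integral_gaussian] at hle
  simp_rw [integral_const_mul, hval, ← sum_mul] at hle
  have hpos : 0 < √(π / v) := sqrt_pos.2 (div_pos pi_pos hv)
  have e : √(π / (v / 2)) = √2 * √(π / v) := by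
    rw [← sqrt_mul (by norm_num)]; congr 1; field_simp
  rw [e] at hle
  exact le_of_mul_le_mul_right hle hpos

section Events

variable {n m : ℕ}

theorem sum_rowWeight_mul_exp_sq_le {q : ℝ} (hq : q ∈ Set.Icc (0 : ℝ) 1) (E : Finset (Fin m))
    (hE : E.Nonempty) :
    ∑ r, rowWeight q r * exp ((∑ j ∈ E, errDev q (r j)) ^ 2 / (4 * #E)) ≤ √2 := by
  have hk : (0 : ℝ) < #E := by exact_mod_cast hE.card_pos
  refine sum_mul_exp_sq_le _ _ hk fun θ => ?_
  have h := sum_rowWeight_mul_prod (m := m) q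
    (fun j b => if j ∈ E then exp (θ * errDev q b) else 1)
  have e : ∀ r : Fin m → Bool, exp (θ * ∑ j ∈ E, errDev q (r j)) =
      ∏ j, if j ∈ E then exp (θ * errDev q (r j)) else 1 := by
    intro r
    rw [mul_sum, exp_sum, prod_ite_mem, univ_inter]
  simp_rw [e]
  rw [h]
  calc _ ≤ ∏ j, if j ∈ E then exp (θ ^ 2 / 2) else 1 := by
        refine prod_le_prod (fun j _ => ?_) fun j _ => ?_
        · split_ifs
          · exact add_nonneg (mul_nonneg (sub_nonneg.2 hq.2) (exp_pos _).le)
              (mul_nonneg hq.1 (exp_pos _).le)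
          · simp
        · split_ifs
          · exact mgf_errDev_le hq θ
          · simp
    _ = exp (#E * θ ^ 2 / 2) := by
        rw [prod_ite_mem, univ_inter, prod_const, ← exp_nat_mul]; ring_nf

/-- The deviations of the answers to any set of items are not aligned: the matrix of deviations
acts on indicator vectors like a matrix of spectral norm `O(√m)`. -/
def SpreadDeviations (q : Fin n → ℝ) (z : Fin n → Fin m → Bool) : Prop :=
  ∀ E : Finset (Fin m), ∑ i, (∑ j ∈ E, errDev (q i) (z i j)) ^ 2 ≤ 8 * m * #E

theorem matrixProb_not_spreadDeviations_le (hm : 0 < m) (hnm : n ≤ m) {q : Fin n → ℝ}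
    (hq : ∀ i, q i ∈ Set.Icc (0 : ℝ) 1) :
    matrixProb q {z : Fin n → Fin m → Bool | ¬ SpreadDeviations q z} ≤ 2 / m := by
  have hm' : (0 : ℝ) < m := by positivity
  let A : Finset (Fin m) → Set (Fin n → Fin m → Bool) :=
    fun E => {z | 8 * m * (#E : ℝ) < ∑ i, (∑ j ∈ E, errDev (q i) (z i j)) ^ 2}
  have hA : ∀ E, matrixProb q (A E) ≤ √2 ^ m / exp (2 * m) := by
    intro E
    rcases E.eq_empty_or_nonempty with rfl | hE
    · have : A ∅ = ∅ := by ext z; simp [A]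
      rw [this]
      simp only [matrixProb, Set.indicator_empty, sum_const_zero]
      positivity
    have hk : (0 : ℝ) < #E := by exact_mod_cast hE.card_pos
    refine matrixProb_le_div hq
      (f := fun z => ∏ i, exp ((∑ j ∈ E, errDev (q i) (z i j)) ^ 2 / (4 * #E)))
      (fun z => prod_nonneg fun i _ => (exp_pos _).le) (exp_pos _) ?_ ?_
    · rw [sum_matrixWeight_mul_prod q
        (fun i r => exp ((∑ j ∈ E, errDev (q i) (r j)) ^ 2 / (4 * #E)))]
      calc _ ≤ ∏ i : Fin n, √2 := prod_le_prod (fun i _ => sum_nonneg fun r _ =>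
            mul_nonneg (rowWeight_nonneg (hq i) r) (exp_pos _).le)
            fun i _ => sum_rowWeight_mul_exp_sq_le (hq i) E hE
        _ = √2 ^ n := by simp
        _ ≤ √2 ^ m := pow_le_pow_right₀ (by rw [one_le_sqrt]; norm_num) hnm
    · intro z hz
      rw [← exp_sum, ← sum_div]
      apply exp_le_exp.2
      rw [le_div_iff₀ (by positivity)]
      have : 8 * m * (#E : ℝ) < ∑ i, (∑ j ∈ E, errDev (q i) (z i j)) ^ 2 := hz
      linarith
  have hsub : {z : Fin n → Fin m → Bool | ¬ SpreadDeviations q z} ⊆ ⋃ E, A E := by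
    intro z hz
    simp only [SpreadDeviations, Set.mem_ofPred_eq, not_forall, not_le] at hz
    exact Set.mem_iUnion.2 hz
  calc _ ≤ ∑ E, matrixProb q (A E) := (matrixProb_mono hq hsub).trans (matrixProb_iUnion_le hq A)
    _ ≤ ∑ E : Finset (Fin m), √2 ^ m / exp (2 * m) := sum_le_sum fun E _ => hA E
    _ = (2 * √2 / exp 2) ^ m := by
        simp only [sum_const, card_univ, Fintype.card_finset, Fintype.card_fin, nsmul_eq_mul]
        rw [div_pow, mul_pow, ← exp_nat_mul, mul_comm (m : ℝ) 2]; push_cast; ring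
    _ ≤ (exp (-(1 / 2))) ^ m := by
        refine pow_le_pow_left₀ (by positivity) ?_ m
        rw [div_le_iff₀ (exp_pos _), ← exp_add]
        have h1 := quadratic_le_exp_of_nonneg (show (0 : ℝ) ≤ -(1 / 2) + 2 by norm_num)
        have h2 : √2 ≤ 1.4143 := by rw [sqrt_le_left (by norm_num)]; norm_num
        norm_num at h1 h2 ⊢
        linarith
    _ = (exp (m / 2))⁻¹ := by rw [← exp_nat_mul, ← exp_neg]; ring_nf
    _ ≤ 2 / m := by
        rw [inv_le_comm₀ (exp_pos _) (by positivity), inv_div]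
        linarith [add_one_le_exp ((m : ℝ) / 2)]

/-- The error rates of all workers are estimated well by the true labels. -/
def RatesClose (q : Fin n → ℝ) (z : Fin n → Fin m → Bool) : Prop :=
  ∀ i, |wrongFrac (z i) - q i| ≤ 1 / 200

theorem matrixProb_not_ratesClose_le (hm : 0 < m) (hnm : n ≤ m) {q : Fin n → ℝ}
    (hq : ∀ i, q i ∈ Set.Icc (0 : ℝ) 1) :
    matrixProb q {z : Fin n → Fin m → Bool | ¬ RatesClose q z} ≤ 8 * 160000 ^ 2 / m := by
  have hm' : (0 : ℝ) < m := by positivity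
  let A : Fin n → Set (Fin n → Fin m → Bool) := fun i => {z | 1 / 200 < |wrongFrac (z i) - q i|}
  have hA : ∀ i, matrixProb q (A i) ≤ √2 / exp (m / 160000) := by
    intro i
    have hne : (univ : Finset (Fin m)).Nonempty := ⟨⟨0, hm⟩, mem_univ _⟩
    refine matrixProb_le_div hq
      (f := fun z => exp ((∑ j, errDev (q i) (z i j)) ^ 2 / (4 * #(univ : Finset (Fin m)))))
      (fun z => (exp_pos _).le) (exp_pos _) ?_ ?_
    · rw [sum_matrixWeight_mul_row q i
        (fun r => exp ((∑ j, errDev (q i) (r j)) ^ 2 / (4 * #(univ : Finset (Fin m)))))]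
      exact sum_rowWeight_mul_exp_sq_le (hq i) univ hne
    · intro z hz
      have hz' : 1 / 200 < |wrongFrac (z i) - q i| := hz
      rw [wrongFrac_sub hm, abs_div, abs_of_pos hm', lt_div_iff₀ hm'] at hz'
      apply exp_le_exp.2
      rw [card_univ, Fintype.card_fin, le_div_iff₀ (by positivity), ← sq_abs]
      nlinarith
  have hsub : {z : Fin n → Fin m → Bool | ¬ RatesClose q z} ⊆ ⋃ i, A i := by
    intro z hz
    simp only [RatesClose, Set.mem_ofPred_eq, not_forall, not_le] at hz
    exact Set.mem_iUnion.2 hz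
  calc _ ≤ ∑ i, matrixProb q (A i) := (matrixProb_mono hq hsub).trans (matrixProb_iUnion_le hq A)
    _ ≤ ∑ i : Fin n, √2 / exp (m / 160000) := sum_le_sum fun i _ => hA i
    _ ≤ m * (2 / exp (m / 160000)) := by
        simp only [sum_const, card_univ, Fintype.card_fin, nsmul_eq_mul]
        have h2 : √2 ≤ 2 := by rw [sqrt_le_left (by norm_num)]; norm_num
        have h3 : (n : ℝ) ≤ m := by exact_mod_cast hnm
        gcongr
    _ ≤ _ := by
        -- `exp x ≥ (x / 2) ^ 2`
        have h1 := add_one_le_exp ((m : ℝ) / 320000)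
        have h2 : exp ((m : ℝ) / 160000) = exp ((m : ℝ) / 320000) ^ 2 := by
          rw [← exp_nat_mul]; congr 1; push_cast; ring
        rw [mul_div_assoc', div_le_div_iff₀ (exp_pos _) hm', h2]
        have h3 : ((m : ℝ) / 320000) ^ 2 ≤ exp ((m : ℝ) / 320000) ^ 2 :=
          pow_le_pow_left₀ (by positivity) (by linarith) 2
        nlinarith

theorem matrixProb_aggregate_le (hn : 0 < n) (hm : 0 < m) {q σ : Fin n → ℝ}
    (hq : ∀ i, q i ∈ Set.Icc (0 : ℝ) 1) (hσ : ∀ i, σ i ^ 2 = 1) :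
    matrixProb q {z : Fin n → Fin m → Bool |
      3 / 2 * √(n * m * log m) < ∑ i, ∑ j, σ i * errDev (q i) (z i j)} ≤ 1 / m := by
  have hm' : (0 : ℝ) < m := by positivity
  have hn' : (0 : ℝ) < n := by positivity
  have hlog : 0 ≤ log (m : ℝ) := log_natCast_nonneg m
  -- Chernoff's bound at the optimal `θ = t / (n * m)` is `exp (-t ^ 2 / (2 * n * m)) = m ^ (-9 / 8)`
  set t := 3 / 2 * √(n * m * log m) with ht
  set θ := t / (n * m) with hθ
  have ht2 : t ^ 2 = 9 / 4 * (n * m * log m) := by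
    rw [ht, mul_pow, sq_sqrt (by positivity)]; norm_num
  have hθ0 : 0 ≤ θ := by rw [hθ, ht]; positivity
  have hmgf : ∑ z : Fin n → Fin m → Bool, matrixWeight q z *
      ∏ i, ∏ j, exp (θ * (σ i * errDev (q i) (z i j))) ≤ exp (n * m * θ ^ 2 / 2) := by
    rw [sum_matrixWeight_mul_prod q (fun i r => ∏ j, exp (θ * (σ i * errDev (q i) (r j))))]
    simp_rw [fun i => sum_rowWeight_mul_prod (m := m) (q i)
      (fun _ b => exp (θ * (σ i * errDev (q i) b)))]
    calc _ ≤ ∏ i : Fin n, ∏ j : Fin m, exp (θ ^ 2 / 2) := by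
          have h0 : ∀ i, 0 ≤ (1 - q i) * exp (θ * (σ i * errDev (q i) true)) +
              q i * exp (θ * (σ i * errDev (q i) false)) := fun i =>
            add_nonneg (mul_nonneg (sub_nonneg.2 (hq i).2) (exp_pos _).le)
              (mul_nonneg (hq i).1 (exp_pos _).le)
          refine prod_le_prod (fun i _ => prod_nonneg fun j _ => h0 i) fun i _ =>
            prod_le_prod (fun j _ => h0 i) fun j _ => ?_
          have := mgf_errDev_le (hq i) (θ * σ i)
          rw [mul_pow, hσ i, mul_one] at this
          simpa only [mul_assoc] using this
      _ = _ := by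
          simp only [prod_const, card_univ, Fintype.card_fin]
          rw [← exp_nat_mul, ← exp_nat_mul]; ring_nf
  have h := matrixProb_le_div (m := m) hq (f := fun z => ∏ i, ∏ j,
    exp (θ * (σ i * errDev (q i) (z i j)))) (t := exp (θ * t))
    (A := {z | t < ∑ i, ∑ j, σ i * errDev (q i) (z i j)})
    (fun z => prod_nonneg fun i _ => prod_nonneg fun j _ => (exp_pos _).le) (exp_pos _) hmgf
    (fun z hz => by
      simp_rw [← exp_sum, ← mul_sum]
      exact exp_le_exp.2 (mul_le_mul_of_nonneg_left
        (by simpa only [mul_sum] using le_of_lt hz) hθ0))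
  refine h.trans ?_
  rw [← exp_sub]
  have e : n * m * θ ^ 2 / 2 - θ * t = -(9 / 8 * log m) := by
    have : n * m * θ ^ 2 / 2 - θ * t = -(t ^ 2 / (2 * (n * m))) := by
      rw [hθ]; field_simp; ring
    rw [this, ht2]; field_simp; ring
  rw [e, one_div, ← exp_log hm', ← exp_neg, exp_le_exp, log_exp]
  linarith

/-- The bound of `SpreadDeviations` passes from sets to soft assignments, since the left side
minus the right side is a convex function. -/
theorem SpreadDeviations.sum_sq_le {q : Fin n → ℝ} {z : Fin n → Fin m → Bool}
    (h : SpreadDeviations q z) {e : Fin m → ℝ} (he : ∀ j, e j ∈ Set.Icc (0 : ℝ) 1) :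
    ∑ i, (∑ j, e j * errDev (q i) (z i j)) ^ 2 ≤ 8 * m * ∑ j, e j := by
  classical
  let f : (Fin m → ℝ) → ℝ :=
    fun e => ∑ i, (∑ j, e j * errDev (q i) (z i j)) ^ 2 - 8 * m * ∑ j, e j
  have hconv : ConvexOn ℝ Set.univ f := by
    refine ⟨convex_univ, fun x _ y _ a b ha hb hab => ?_⟩
    have hlin : ∀ c : Fin m → ℝ, ∑ j, (a • x + b • y) j * c j =
        a * ∑ j, x j * c j + b * ∑ j, y j * c j := by
      intro c
      rw [mul_sum, mul_sum, ← sum_add_distrib]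
      refine sum_congr rfl fun j _ => ?_
      simp only [Pi.add_apply, Pi.smul_apply, smul_eq_mul]; ring
    have hlin1 := hlin fun _ => 1
    simp only [mul_one] at hlin1
    have hsq : ∀ u v : ℝ, (a * u + b * v) ^ 2 ≤ a * u ^ 2 + b * v ^ 2 := by
      intro u v
      have := mul_nonneg (mul_nonneg ha hb) (sq_nonneg (u - v))
      obtain rfl : b = 1 - a := by linarith
      nlinarith
    simp only [f, hlin, hlin1, smul_eq_mul]
    have := sum_le_sum fun i (_ : i ∈ (univ : Finset (Fin n))) =>
      hsq (∑ j, x j * errDev (q i) (z i j)) (∑ j, y j * errDev (q i) (z i j))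
    rw [sum_add_distrib, ← mul_sum, ← mul_sum] at this
    linarith
  have hmem : e ∈ convexHull ℝ (Set.pi Set.univ fun _ : Fin m => ({0, 1} : Set ℝ)) := by
    rw [convexHull_pi]
    intro j _
    rw [convexHull_pair, segment_eq_Icc zero_le_one]
    exact he j
  obtain ⟨v, hv, hle⟩ := (hconv.subset (Set.subset_univ _) (convex_convexHull ℝ _)
    ).exists_ge_of_mem_convexHull (subset_convexHull ℝ _) hmem
  have hv' : ∀ j, v j = if v j = 1 then 1 else 0 := by
    intro j
    have := hv j (Set.mem_univ j)
    rcases this with h | h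
    · rw [h]; simp
    · rw [Set.mem_singleton_iff.1 h]; simp
  have hE := h (univ.filter fun j => v j = 1)
  have e1 : ∀ c : Fin m → ℝ, ∑ j, v j * c j = ∑ j with v j = 1, c j := by
    intro c
    rw [sum_filter]
    refine sum_congr rfl fun j _ => ?_
    by_cases hj : v j = 1
    · rw [if_pos hj, hj, one_mul]
    · have := hv' j
      rw [if_neg hj] at this
      rw [if_neg hj, this, zero_mul]
  have e2 := e1 fun _ => 1
  simp only [mul_one, sum_const, nsmul_eq_mul] at e2
  simp only [f, e1, e2] at hle
  linarith

end Events

/-! ### Deterministic analysis of the potential -/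

section Potential

variable {n m : ℕ}

/-- The expected fraction of wrong answers of a worker when the truth is perturbed by soft label
errors `e`, where `r j` tells whether the answer to item `j` is correct. For `0`-`1` answers `r` and a
soft labeling `e` the same expression is the agreement of the answers with the labeling. -/
noncomputable def flipFrac (r : Fin m → Bool) (e : Fin m → ℝ) : ℝ :=
  (∑ j, if r j then e j else 1 - e j) / m

/-- The objective, maximized over the abilities, as a function of the label errors `e`. Since
`flipFrac` is also the agreement with a labeling, it may be read as a function of raw answers and
labels as well. -/
noncomputable def potential (z : Fin n → Fin m → Bool) (e : Fin m → ℝ) : ℝ :=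
  ∑ j, binEntropy (e j) - m * ∑ i, binEntropy (flipFrac (z i) e)

/-- The soft labeling with errors `e` is a global maximizer of the potential. -/
structure IsPotentialMax (z : Fin n → Fin m → Bool) (e : Fin m → ℝ) : Prop where
  mem : ∀ j, e j ∈ Set.Icc (0 : ℝ) 1
  le : ∀ e' : Fin m → ℝ, (∀ j, e' j ∈ Set.Icc (0 : ℝ) 1) → potential z e' ≤ potential z e

theorem flipFrac_eq (r : Fin m → Bool) (e : Fin m → ℝ) :
    flipFrac r e = wrongFrac r + (∑ j, e j * sgn (r j)) / m := by
  unfold flipFrac wrongFrac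
  rw [← add_div, ← sum_add_distrib]
  congr 1
  refine sum_congr rfl fun j _ => ?_
  cases r j <;> simp [sgn]; ring

theorem flipFrac_zero (r : Fin m → Bool) : flipFrac r (fun _ => 0) = wrongFrac r := by
  simp [flipFrac_eq]

theorem flipFrac_one_sub (hm : 0 < m) (r : Fin m → Bool) (e : Fin m → ℝ) :
    flipFrac r (fun j => 1 - e j) = 1 - flipFrac r e := by
  have hm' : (m : ℝ) ≠ 0 := by positivity
  unfold flipFrac
  rw [eq_sub_iff_add_eq, ← add_div, ← sum_add_distrib, div_eq_one_iff_eq hm']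
  rw [sum_congr rfl (g := fun _ => (1 : ℝ))]
  · simp
  · intro j _; split_ifs <;> ring

theorem flipFrac_mem (r : Fin m → Bool) {e : Fin m → ℝ} (he : ∀ j, e j ∈ Set.Icc (0 : ℝ) 1) :
    flipFrac r e ∈ Set.Icc (0 : ℝ) 1 := by
  have h : ∀ j, (if r j then e j else 1 - e j) ∈ Set.Icc (0 : ℝ) 1 := by
    intro j; split_ifs
    · exact he j
    · exact ⟨by linarith [(he j).2], by linarith [(he j).1]⟩
  unfold flipFrac
  refine ⟨div_nonneg (sum_nonneg fun j _ => (h j).1) (by positivity), ?_⟩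
  apply div_le_one_of_le₀ _ (by positivity)
  calc _ ≤ ∑ j : Fin m, (1 : ℝ) := sum_le_sum fun j _ => (h j).2
    _ = m := by simp

theorem potential_one_sub (hm : 0 < m) (z : Fin n → Fin m → Bool) (e : Fin m → ℝ) :
    potential z (fun j => 1 - e j) = potential z e := by
  simp only [potential, flipFrac_one_sub hm, binEntropy_one_sub]

theorem IsPotentialMax.one_sub (hm : 0 < m) {z : Fin n → Fin m → Bool} {e : Fin m → ℝ}
    (h : IsPotentialMax z e) : IsPotentialMax z (fun j => 1 - e j) where
  mem j := ⟨by linarith [(h.mem j).2], by linarith [(h.mem j).1]⟩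
  le e' he' := by rw [potential_one_sub hm]; exact h.le e' he'

/-- Comparison of a maximizer with the true labels. -/
theorem IsPotentialMax.mul_sum_sub_le {z : Fin n → Fin m → Bool} {e : Fin m → ℝ}
    (h : IsPotentialMax z e) :
    m * ∑ i, (binEntropy (flipFrac (z i) e) - binEntropy (wrongFrac (z i))) ≤
      ∑ j, binEntropy (e j) := by
  have h0 := h.le (fun _ => 0) fun _ => by simp
  simp only [potential, flipFrac_zero, binEntropy_zero, sum_const_zero, zero_sub] at h0
  rw [sum_sub_distrib, mul_sub]
  linarith

theorem entropyGap_one_sub_two_mul (b : ℝ) : entropyGap (1 - 2 * b) = log 2 - binEntropy b := by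
  unfold entropyGap
  rw [← binEntropy_one_sub b]
  congr 2; ring

/-- A maximizer of the potential is either close to the truth or close to the opposite of the
truth: the agreement of every worker with the labels is contracted by the factor `|1 - 2 ē|`, which
costs a positive fraction of the collective wisdom, whereas overfitting and the entropy of the
labels only gain `O(1)`. -/
theorem IsPotentialMax.mean_dichotomy (hm : 0 < m) {q : Fin n → ℝ}
    {z : Fin n → Fin m → Bool} {e : Fin m → ℝ} (h : IsPotentialMax z e)
    (hz : SpreadDeviations q z) (hK : 2 * 10 ^ 10 ≤ ∑ i, (1 - 2 * q i) ^ 2) :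
    (∑ j, e j) / m ≤ 1 / 300 ∨ 299 / 300 ≤ (∑ j, e j) / m := by
  have hm' : (0 : ℝ) < m := by positivity
  by_contra! hcon
  obtain ⟨hlo, hhi⟩ := hcon
  set a := (∑ j, e j) / m with ha
  have hsum : ∑ j, e j = a * m := by rw [ha]; field_simp
  let Y : Fin n → ℝ := fun i => (∑ j, errDev (q i) (z i j)) / m
  let Y' : Fin n → ℝ := fun i => (∑ j, e j * errDev (q i) (z i j)) / m
  have hY : ∑ i, Y i ^ 2 ≤ 8 := by
    have := hz univ
    simp only [Y, div_pow, ← sum_div]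
    rw [div_le_iff₀ (by positivity)]
    simp only [card_univ, Fintype.card_fin] at this
    nlinarith
  have hY' : ∑ i, Y' i ^ 2 ≤ 8 := by
    have := hz.sum_sq_le h.mem
    simp only [Y', div_pow, ← sum_div]
    rw [div_le_iff₀ (by positivity)]
    rw [hsum] at this
    nlinarith
  have hs : ∀ i, 1 - 2 * wrongFrac (z i) = (1 - 2 * q i) - 2 * Y i := by
    intro i
    have := wrongFrac_sub hm (q i) (z i)
    simp only [Y]; linarith
  have hg : ∀ i, 1 - 2 * flipFrac (z i) e =
      (1 - 2 * a) * (1 - 2 * wrongFrac (z i)) + (4 * Y' i - 4 * a * Y i) := by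
    intro i
    have e1 : ∑ j, e j * sgn (z i j) = (1 - 2 * q i) * (a * m) -
        2 * ∑ j, e j * errDev (q i) (z i j) := by
      rw [← hsum, mul_sum, mul_sum, ← sum_sub_distrib]
      refine sum_congr rfl fun j _ => ?_
      rw [sgn_eq (q i)]; ring
    rw [flipFrac_eq, e1, sub_div]
    have e2 := hs i
    have e3 : (1 - 2 * q i) * (a * m) / m = (1 - 2 * q i) * a := by field_simp
    have e4 : (2 * ∑ j, e j * errDev (q i) (z i j)) / m = 2 * Y' i := by simp only [Y']; ring
    rw [e3, e4]
    linear_combination 2 * a * e2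
  have habs : ∀ b : ℝ, b ∈ Set.Icc (0 : ℝ) 1 → |1 - 2 * b| ≤ 1 := fun b hb =>
    abs_le.2 ⟨by linarith [hb.2], by linarith [hb.1]⟩
  have hc : |1 - 2 * a| ≤ 1 - 1 / 150 := abs_le.2 ⟨by linarith, by linarith⟩
  -- `entropyGap_contract_add` with `η = 1 / 150`, since `|1 - 2 * a| ≤ 1 - 2 / 300`
  have hgap : ∀ i, entropyGap (1 - 2 * flipFrac (z i) e) ≤ (1 - 1 / 150) *
      entropyGap (1 - 2 * wrongFrac (z i)) + 22500 * 32 * (Y' i ^ 2 + Y i ^ 2) := by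
    intro i
    have hfl := habs _ (flipFrac_mem (z i) h.mem)
    rw [hg i] at hfl ⊢
    have h1 := entropyGap_contract_add (η := 1 / 150) (by norm_num) (by norm_num) hc
      (habs _ (wrongFrac_mem (z i))) hfl
    have h2 := mul_le_mul_of_nonneg_right hc (entropyGap_nonneg (1 - 2 * wrongFrac (z i)))
    have h3 : (4 * Y' i - 4 * a * Y i) ^ 2 ≤ 32 * (Y' i ^ 2 + Y i ^ 2) := by
      have ha2 : a ^ 2 ≤ 1 := by nlinarith
      nlinarith [sq_nonneg (Y' i + a * Y i), mul_le_mul_of_nonneg_right ha2 (sq_nonneg (Y i))]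
    norm_num at h1 ⊢
    linarith
  have hgapsum := sum_le_sum fun i (_ : i ∈ univ) => hgap i
  rw [sum_add_distrib, ← mul_sum, ← mul_sum, sum_add_distrib] at hgapsum
  have hlow : ∀ i, (1 - 2 * q i) ^ 2 / 8 - Y i ^ 2 ≤ entropyGap (1 - 2 * wrongFrac (z i)) := by
    intro i
    refine le_trans ?_ (sq_div_four_le_entropyGap (habs _ (wrongFrac_mem (z i))))
    rw [hs i]
    nlinarith [sq_nonneg ((1 - 2 * q i) - 4 * Y i)]
  have hlowsum := sum_le_sum fun i (_ : i ∈ univ) => hlow i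
  rw [sum_sub_distrib, ← sum_div] at hlowsum
  have hcmp := h.mul_sum_sub_le
  have hent : ∑ j, binEntropy (e j) ≤ m * 1 := by
    calc _ ≤ ∑ j : Fin m, (1 : ℝ) := sum_le_sum fun j _ =>
          binEntropy_le_log_two.trans (by linarith [log_two_lt_d9])
      _ = m * 1 := by simp
  have hcmp2 := le_of_mul_le_mul_left (hcmp.trans hent) hm'
  have hrw : ∑ i, (binEntropy (flipFrac (z i) e) - binEntropy (wrongFrac (z i))) =
      ∑ i, entropyGap (1 - 2 * wrongFrac (z i)) - ∑ i, entropyGap (1 - 2 * flipFrac (z i) e) := by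
    rw [← sum_sub_distrib]
    refine sum_congr rfl fun i _ => ?_
    rw [entropyGap_one_sub_two_mul, entropyGap_one_sub_two_mul]; ring
  rw [hrw] at hcmp2
  norm_num at hK hgapsum
  linarith

/-- Contribution of a worker to the log likelihood ratio of the labels "correct" and "wrong" of an
item; the logarithm of `errFactor` is at least minus half of it. -/
noncomputable def logFactor (ρ q b : ℝ) (c : Bool) : ℝ :=
  if q < 1 / 25 then (if c then log ((1 - (b + ρ)) / (b + ρ)) else -(log (1 / b) + 1))
  else sgn c * log ((1 - b) / b)

theorem exp_neg_half_mul_log {y : ℝ} (hy : 0 < y) : exp (-(log y) / 2) = √(1 / y) := by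
  rw [← exp_log (show (0 : ℝ) < √(1 / y) by positivity), log_sqrt (by positivity), one_div, log_inv]

theorem exp_neg_logFactor_le {ρ q b : ℝ} {c : Bool} (hρ0 : 0 < ρ) (hρ : ρ ≤ 1 / 300)
    (hq : q ∈ Set.Icc (0 : ℝ) (1 / 2)) (hb : |b - q| ≤ 1 / 200) (hb0 : 0 ≤ b)
    (hbc : c = false → 0 < b) :
    exp (-(logFactor ρ q b c) / 2) ≤ errFactor ρ q b c := by
  obtain ⟨h1, h2⟩ := abs_le.1 hb
  unfold logFactor errFactor
  by_cases hqG : q < 1 / 25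
  · simp only [hqG, if_true]
    cases c
    · have hb1 := hbc rfl
      simp only [Bool.false_eq_true, if_false]
      rw [← exp_log (show (0 : ℝ) < √(exp 1 / b) by positivity), log_sqrt (by positivity),
        log_div (exp_pos _).ne' hb1.ne', log_exp, one_div, log_inv]
      apply le_of_eq; congr 1; ring
    · simp only [if_true]
      have hx0 : 0 < b + ρ := by linarith
      have hx1 : b + ρ ≤ 1 / 20 := by linarith
      have hx2 : 0 < 1 - (b + ρ) := by linarith
      rw [exp_neg_half_mul_log (by positivity)]
      have h103 : (103 / 100 : ℝ) = √((103 / 100) ^ 2) := by rw [sqrt_sq (by norm_num)]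
      rw [h103, ← sqrt_mul (by positivity)]
      apply sqrt_le_sqrt
      rw [one_div_div, div_le_iff₀ hx2]
      nlinarith
  · simp only [hqG, if_false]
    have hb1 : 0 < b := by linarith [not_lt.1 hqG]
    have hb2 : 0 < 1 - b := by linarith [hq.2]
    cases c
    · simp only [Bool.false_eq_true, if_false, sgn]
      have e : -(-1 * log ((1 - b) / b)) / 2 = -(log (b / (1 - b))) / 2 := by
        rw [log_div hb2.ne' hb1.ne', log_div hb1.ne' hb2.ne']; ring
      rw [e, exp_neg_half_mul_log (by positivity), one_div_div]
    · simp only [if_true, sgn, one_mul]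
      rw [exp_neg_half_mul_log (by positivity), one_div_div]

/-- Lower bound, linear in the label errors up to a quadratic term, for the entropy that a single
worker loses by the label errors. -/
theorem sum_mul_logFactor_sub_le (hm : 0 < m) {ρ q : ℝ} (hρ : ρ ≤ 1 / 300)
    (hq : q ∈ Set.Icc (0 : ℝ) (1 / 2)) {r : Fin m → Bool} (hb : |wrongFrac r - q| ≤ 1 / 200)
    {e : Fin m → ℝ} (he : ∀ j, e j ∈ Set.Icc (0 : ℝ) 1) (hmean : (∑ j, e j) / m ≤ ρ) :
    ∑ j, e j * logFactor ρ q (wrongFrac r) (r j) - 35 * m * ((∑ j, e j * sgn (r j)) / m) ^ 2 ≤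
      m * (binEntropy (flipFrac r e) - binEntropy (wrongFrac r)) := by
  have hm' : (0 : ℝ) < m := by positivity
  have hw := wrongFrac_mem r
  have hfl := flipFrac_mem r he
  have hfe := flipFrac_eq r e
  obtain ⟨h1, h2⟩ := abs_le.1 hb
  set b := wrongFrac r with hbdef
  by_cases hqG : q < 1 / 25
  · let R := (∑ j, if r j then e j else 0) / m
    let U := (∑ j, if r j then 0 else e j) / m
    have hR0 : 0 ≤ R := div_nonneg (sum_nonneg fun j _ => by
      split_ifs; exacts [(he j).1, le_rfl]) hm'.le
    have hU0 : 0 ≤ U := div_nonneg (sum_nonneg fun j _ => by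
      split_ifs; exacts [le_rfl, (he j).1]) hm'.le
    have hUb : U ≤ b := by
      simp only [U, hbdef, wrongFrac]
      refine div_le_div_of_nonneg_right (sum_le_sum fun j _ => ?_) hm'.le
      split_ifs; exacts [le_rfl, (he j).2]
    have hRU : R + U = (∑ j, e j) / m := by
      simp only [R, U]
      rw [← add_div, ← sum_add_distrib]
      congr 1; refine sum_congr rfl fun j _ => ?_
      split_ifs <;> ring
    have hflip : flipFrac r e = b + R - U := by
      rw [hfe, add_sub_assoc]
      simp only [R, U]
      rw [← sub_div, ← sum_sub_distrib]
      congr 2; refine sum_congr rfl fun j _ => ?_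
      cases r j <;> simp [sgn]
    have hmain := binEntropy_add_sub_ge (b := b) (r := R) (u := U) (x := b + ρ) hw.1 hR0 hU0 hUb
      (by linarith) (by linarith)
    rw [← hflip] at hmain
    have hsum : ∑ j, e j * logFactor ρ q b (r j) =
        m * (R * log ((1 - (b + ρ)) / (b + ρ)) - U * (log (1 / b) + 1)) := by
      have e1 : m * R = ∑ j, if r j then e j else 0 := by simp only [R]; field_simp
      have e2 : m * U = ∑ j, if r j then 0 else e j := by simp only [U]; field_simp
      rw [mul_sub, ← mul_assoc, ← mul_assoc, e1, e2, sum_mul, sum_mul, ← sum_sub_distrib]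
      refine sum_congr rfl fun j _ => ?_
      simp only [logFactor, hqG, if_true]
      cases r j
      · simp only [Bool.false_eq_true, if_false]; ring
      · simp only [if_true]; ring
    rw [hsum]
    have := mul_le_mul_of_nonneg_left hmain hm'.le
    have h3 : 0 ≤ 35 * m * ((∑ j, e j * sgn (r j)) / m) ^ 2 := by positivity
    linarith
  · have hb1 : 7 / 200 ≤ b := by linarith [not_lt.1 hqG]
    have hb2 : b ≤ 101 / 200 := by linarith [hq.2]
    have hmain := binEntropy_ge_tangent_sub_sq hfl (b := b) (by linarith) (by linarith)
    have hδ : flipFrac r e - b = (∑ j, e j * sgn (r j)) / m := by rw [hfe]; ring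
    rw [hδ] at hmain
    have hsum : ∑ j, e j * logFactor ρ q b (r j) =
        m * ((∑ j, e j * sgn (r j)) / m * log ((1 - b) / b)) := by
      rw [← mul_assoc, mul_div_cancel₀ _ hm'.ne', sum_mul]
      refine sum_congr rfl fun j _ => ?_
      simp only [logFactor, hqG, if_false, mul_assoc]
    -- `1 / (b * (1 - b)) ≤ 35` on `[7 / 200, 101 / 200]`
    have hquad : ((∑ j, e j * sgn (r j)) / m) ^ 2 / (b * (1 - b)) ≤
        35 * ((∑ j, e j * sgn (r j)) / m) ^ 2 := by
      rw [div_le_iff₀ (by nlinarith)]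
      have : 1 ≤ 35 * (b * (1 - b)) := by nlinarith
      nlinarith [sq_nonneg ((∑ j, e j * sgn (r j)) / m)]
    rw [hsum]
    have := mul_le_mul_of_nonneg_left hmain hm'.le
    nlinarith

/-- The self-bounding estimate: a maximizer of the potential that is not too far from the truth has
an average error controlled by the average of `errFactor`. -/
theorem IsPotentialMax.mean_le (hm : 0 < m) {ρ : ℝ} (hρ0 : 0 < ρ) (hρ : ρ ≤ 1 / 300) {q : Fin n → ℝ}
    (hq : ∀ i, q i ∈ Set.Icc (0 : ℝ) (1 / 2)) {z : Fin n → Fin m → Bool} {e : Fin m → ℝ}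
    (h : IsPotentialMax z e) (hz : SpreadDeviations q z) (hz' : RatesClose q z)
    (hmean : (∑ j, e j) / m ≤ ρ) :
    (∑ j, e j) / m ≤ exp (1121 + 35 * ρ * ∑ i, (1 - 2 * q i) ^ 2) * avgErrFactor ρ q z := by
  have hm' : (0 : ℝ) < m := by positivity
  set K := ∑ i, (1 - 2 * q i) ^ 2 with hK
  have hK0 : 0 ≤ K := sum_nonneg fun i _ => sq_nonneg _
  set S := ∑ j, e j with hS
  have hS0 : 0 ≤ S := sum_nonneg fun j _ => (h.mem j).1
  have hquad : ∑ i, ((∑ j, e j * sgn (z i j)) / m) ^ 2 ≤ 2 * K * (S / m) ^ 2 + 64 * (S / m) := by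
    have hi : ∀ i, ((∑ j, e j * sgn (z i j)) / m) ^ 2 ≤ 2 * (S / m) ^ 2 * (1 - 2 * q i) ^ 2 +
        8 / m ^ 2 * (∑ j, e j * errDev (q i) (z i j)) ^ 2 := by
      intro i
      have e1 : ∑ j, e j * sgn (z i j) = (1 - 2 * q i) * S -
          2 * ∑ j, e j * errDev (q i) (z i j) := by
        rw [hS, mul_sum, mul_sum, ← sum_sub_distrib]
        refine sum_congr rfl fun j _ => ?_
        rw [sgn_eq (q i)]; ring
      rw [e1]
      set X := ∑ j, e j * errDev (q i) (z i j)
      have e2 : 2 * (S / m) ^ 2 * (1 - 2 * q i) ^ 2 + 8 / m ^ 2 * X ^ 2 -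
          (((1 - 2 * q i) * S - 2 * X) / m) ^ 2 = (((1 - 2 * q i) * S + 2 * X) / m) ^ 2 := by ring
      have := sq_nonneg (((1 - 2 * q i) * S + 2 * X) / m)
      linarith
    refine (sum_le_sum fun i _ => hi i).trans ?_
    rw [sum_add_distrib, ← mul_sum, ← mul_sum, ← hK]
    have h1 := mul_le_mul_of_nonneg_left (hz.sum_sq_le h.mem)
      (show (0 : ℝ) ≤ 8 / m ^ 2 by positivity)
    have e3 : 8 / (m : ℝ) ^ 2 * (8 * m * ∑ j, e j) = 64 * (S / m) := by rw [← hS]; field_simp; ring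
    linarith
  set c := 70 * ρ * K + 2240 with hc
  have hlin : ∑ j, e j * (∑ i, logFactor ρ (q i) (wrongFrac (z i)) (z i j)) - c * S ≤
      ∑ j, binEntropy (e j) := by
    refine le_trans ?_ h.mul_sum_sub_le
    have hrows := sum_le_sum fun i (_ : i ∈ univ) =>
      sum_mul_logFactor_sub_le hm hρ (hq i) (hz' i) h.mem hmean
    rw [← mul_sum] at hrows
    refine le_trans ?_ hrows
    rw [sum_sub_distrib, ← mul_sum, sum_comm]
    simp_rw [← mul_sum]
    have h2 : 35 * (m : ℝ) * ∑ i, ((∑ j, e j * sgn (z i j)) / m) ^ 2 ≤ c * S := by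
      calc _ ≤ 35 * (m : ℝ) * (2 * K * (S / m) ^ 2 + 64 * (S / m)) := by gcongr
        _ = S * (70 * K * (S / m) + 2240) := by field_simp; ring
        _ ≤ S * (70 * K * ρ + 2240) := by gcongr
        _ = c * S := by rw [hc]; ring
    linarith
  have hterm : ∀ j, e j + binEntropy (e j) -
      e j * (∑ i, logFactor ρ (q i) (wrongFrac (z i)) (z i j) - c) ≤
      exp (1121 + 35 * ρ * K) * ∏ i, errFactor ρ (q i) (wrongFrac (z i)) (z i j) := by
    intro j
    refine (add_binEntropy_sub_mul_le (h.mem j)).trans ?_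
    have e1 : 1 - (∑ i, logFactor ρ (q i) (wrongFrac (z i)) (z i j) - c) / 2 =
        (1121 + 35 * ρ * K) + ∑ i, -(logFactor ρ (q i) (wrongFrac (z i)) (z i j)) / 2 := by
      rw [← sum_div, sum_neg_distrib, hc]; ring
    rw [e1, exp_add, exp_sum]
    refine mul_le_mul_of_nonneg_left ?_ (exp_pos _).le
    refine prod_le_prod (fun i _ => (exp_pos _).le) fun i _ =>
      exp_neg_logFactor_le hρ0 hρ (hq i) (hz' i) (wrongFrac_mem _).1 fun hij => ?_
    -- a worker with a wrong answer has a positive fraction of wrong answers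
    refine div_pos (lt_of_lt_of_le one_pos ?_) hm'
    have := single_le_sum (f := fun k => if z i k then (0 : ℝ) else 1)
      (fun k _ => by split_ifs <;> norm_num) (mem_univ j)
    simpa [hij] using this
  have htot := sum_le_sum fun j (_ : j ∈ univ) => hterm j
  simp_rw [mul_sub] at htot
  rw [← mul_sum, sum_sub_distrib, sum_sub_distrib, sum_add_distrib, ← sum_mul, ← hS] at htot
  rw [avgErrFactor, mul_div_assoc']
  refine div_le_div_of_nonneg_right ?_ hm'.le
  linarith

end Potential

/-! ### Elimination of the abilities and of the constraint -/

/-- Minus the cross entropy of the Bernoulli laws with means `a` and `p`, with the real logarithm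
(`log 0 = 0`); the value is meaningful under `CrossFinite`. -/
noncomputable def crossLog (a p : ℝ) : ℝ := a * log p + (1 - a) * log (1 - p)

/-- The cross entropy of the Bernoulli laws with means `a` and `p` is finite. -/
def CrossFinite (a p : ℝ) : Prop := (0 < p ∨ a = 0) ∧ (0 < 1 - p ∨ a = 1)

theorem crossLog_self (a : ℝ) : crossLog a a = -binEntropy a := by
  rw [binEntropy_eq]; unfold crossLog; ring

theorem crossFinite_self {a : ℝ} (ha : a ∈ Set.Icc (0 : ℝ) 1) : CrossFinite a a := by
  refine ⟨ha.1.lt_or_eq.imp_right Eq.symm, ?_⟩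
  rcases ha.2.lt_or_eq with h | h
  · exact Or.inl (by linarith)
  · exact Or.inr h

/-- Gibbs' inequality in its strict form. -/
theorem crossLog_lt_self {a p : ℝ} (ha : a ∈ Set.Icc (0 : ℝ) 1) (hp : p ∈ Set.Icc (0 : ℝ) 1)
    (h : CrossFinite a p) (hne : p ≠ a) : crossLog a p < crossLog a a := by
  unfold crossLog
  rcases ha.1.eq_or_lt with rfl | ha0
  · have hp0 : 0 < p := lt_of_le_of_ne hp.1 hne.symm
    have hp1 : 0 < 1 - p := h.2.resolve_right (by norm_num)
    simpa using log_neg hp1 (by linarith)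
  rcases ha.2.eq_or_lt with rfl | ha1
  · have hp0 : 0 < p := h.1.resolve_right (by norm_num)
    simpa using log_neg hp0 (lt_of_le_of_ne hp.2 hne)
  have hp0 : 0 < p := h.1.resolve_right ha0.ne'
  have hp1 : 0 < 1 - p := h.2.resolve_right ha1.ne
  have ha1' : 0 < 1 - a := by linarith
  have h1 := log_lt_sub_one_of_pos (div_pos hp0 ha0) (by rwa [Ne, div_eq_one_iff_eq ha0.ne'])
  have h2 := log_le_sub_one_of_pos (div_pos hp1 ha1')
  rw [log_div hp0.ne' ha0.ne'] at h1
  rw [log_div hp1.ne' ha1'.ne'] at h2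
  have h3 := mul_lt_mul_of_pos_left h1 ha0
  have h4 := mul_le_mul_of_nonneg_left h2 ha1'.le
  have e1 : a * (p / a - 1) = p - a := by field_simp
  have e2 : (1 - a) * ((1 - p) / (1 - a) - 1) = a - p := by field_simp; ring
  linarith

theorem crossLog_convexComb_ge {a p t : ℝ} (ha : a ∈ Set.Icc (0 : ℝ) 1) (h : CrossFinite a p)
    (ht0 : 0 ≤ t) (ht1 : t ≤ 1) :
    (1 - t) * crossLog a p + t * crossLog a a ≤ crossLog a ((1 - t) * p + t * a) := by
  have key : ∀ b r : ℝ, 0 ≤ b → (0 < r ∨ b = 0) →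
      (1 - t) * (b * log r) + t * (b * log b) ≤ b * log ((1 - t) * r + t * b) := by
    intro b r hb hr
    rcases hb.eq_or_lt with rfl | hb
    · simp
    have hr' := hr.resolve_right hb.ne'
    have := strictConcaveOn_log_Ioi.concaveOn.2 (Set.mem_Ioi.2 hr') (Set.mem_Ioi.2 hb)
      (sub_nonneg.2 ht1) ht0 (by ring)
    simp only [smul_eq_mul] at this
    nlinarith
  have h1 := key a p ha.1 h.1
  have h2 := key (1 - a) (1 - p) (by linarith [ha.2]) (h.2.imp_right fun h => by rw [h]; ring)
  have e : (1 - t) * (1 - p) + t * (1 - a) = 1 - ((1 - t) * p + t * a) := by ring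
  rw [e] at h2
  unfold crossLog
  linarith

theorem crossFinite_convexComb {a p t : ℝ} (ha : a ∈ Set.Icc (0 : ℝ) 1)
    (h : CrossFinite a p) (ht0 : 0 ≤ t) (ht1 : t < 1) :
    CrossFinite a ((1 - t) * p + t * a) := by
  have h1t : 0 < 1 - t := by linarith
  refine ⟨h.1.imp_left fun h => ?_, h.2.imp_left fun h => ?_⟩
  · exact add_pos_of_pos_of_nonneg (mul_pos h1t h) (mul_nonneg ht0 ha.1)
  · have := add_pos_of_pos_of_nonneg (mul_pos h1t h) (mul_nonneg ht0 (sub_nonneg.2 ha.2))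
    linarith

theorem coe_mul_elog {c a : ℝ} (h : 0 < a ∨ c = 0) :
    (c : EReal) * elog a = ((c * log a : ℝ) : EReal) := by
  rcases h with h | rfl
  · rw [elog, if_pos h, EReal.coe_mul]
  · simp

theorem pos_or_eq_zero_of_mul_elog_ne_bot {c a : ℝ} (hc : 0 ≤ c)
    (h : (c : EReal) * elog a ≠ ⊥) : 0 < a ∨ c = 0 := by
  by_contra! hcon
  rw [elog, if_neg (not_lt.2 hcon.1)] at h
  exact h (EReal.coe_mul_bot_of_pos (lt_of_le_of_ne hc hcon.2.symm))

theorem ne_bot_of_sum_ne_bot {ι : Type*} {s : Finset ι} {f : ι → EReal} (h : ∑ i ∈ s, f i ≠ ⊥) :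
    ∀ i ∈ s, f i ≠ ⊥ := by
  classical
  intro i hi hbot
  rw [← add_sum_erase s f hi, hbot, EReal.bot_add] at h
  exact h rfl

theorem coe_sum_ereal {ι : Type*} (s : Finset ι) (f : ι → ℝ) :
    ∑ i ∈ s, (f i : EReal) = ((∑ i ∈ s, f i : ℝ) : EReal) := by
  classical
  induction s using Finset.induction_on with
  | empty => simp
  | insert a s ha ih => rw [sum_insert ha, sum_insert ha, ih, EReal.coe_add]

section Estimator

variable {n m : ℕ}

theorem objective_eq_sum_elog (x : Fin n → Fin m → Bool) (p : Fin n → ℝ) (y : Fin m → ℝ) :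
    objective x p y =
      (∑ i, ∑ j, (y j : EReal) * elog (if x i j then p i else 1 - p i)) +
      (∑ i, ∑ j, ((1 - y j : ℝ) : EReal) * elog (if x i j then 1 - p i else p i)) +
      ((∑ j, binEntropy (y j) : ℝ) : EReal) := by
  unfold objective
  congr 2
  · refine sum_congr rfl fun i _ => sum_congr rfl fun j _ => ?_
    cases x i j <;> simp [label]
  · refine sum_congr rfl fun i _ => sum_congr rfl fun j _ => ?_
    cases x i j <;> simp [label]

/-- The agreement of a worker with a soft labeling is `0` or `1` only if every single answer has the
same agreement. -/
theorem entry_eq_of_flipFrac_eq (hm : 0 < m) {r : Fin m → Bool} {y : Fin m → ℝ}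
    (hy : ∀ j, y j ∈ Set.Icc (0 : ℝ) 1) :
    (flipFrac r y = 0 → ∀ j, (if r j then y j else 1 - y j) = 0) ∧
      (flipFrac r y = 1 → ∀ j, (if r j then y j else 1 - y j) = 1) := by
  have hm' : (m : ℝ) ≠ 0 := by positivity
  have key : ∀ y : Fin m → ℝ, (∀ j, y j ∈ Set.Icc (0 : ℝ) 1) → flipFrac r y = 0 →
      ∀ j, (if r j then y j else 1 - y j) = 0 := by
    intro y hy h j
    rw [flipFrac, div_eq_zero_iff, or_iff_left hm'] at h
    refine (sum_eq_zero_iff_of_nonneg fun j _ => ?_).1 h j (mem_univ j)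
    split_ifs
    exacts [(hy j).1, sub_nonneg.2 (hy j).2]
  refine ⟨key y hy, fun h j => ?_⟩
  have := key (fun j => 1 - y j) (fun j => ⟨sub_nonneg.2 (hy j).2, by linarith [(hy j).1]⟩)
    (by rw [flipFrac_one_sub hm, h, sub_self]) j
  split_ifs at this ⊢ <;> linarith

theorem objective_eq_coe (hm : 0 < m) {x : Fin n → Fin m → Bool} {p : Fin n → ℝ} {y : Fin m → ℝ}
    (hy : ∀ j, y j ∈ Set.Icc (0 : ℝ) 1) (h : ∀ i, CrossFinite (flipFrac (x i) y) (p i)) :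
    objective x p y = ((m * ∑ i, crossLog (flipFrac (x i) y) (p i) + ∑ j, binEntropy (y j) : ℝ) :
      EReal) := by
  have hm' : (m : ℝ) ≠ 0 := by positivity
  rw [objective_eq_sum_elog]
  have h1 : ∀ i j, (y j : EReal) * elog (if x i j then p i else 1 - p i) =
      ((y j * log (if x i j then p i else 1 - p i) : ℝ) : EReal) := by
    intro i j
    apply coe_mul_elog
    obtain ⟨e0, e1⟩ := entry_eq_of_flipFrac_eq hm (r := x i) hy
    split_ifs with hx
    · exact (h i).1.imp_right fun h => by simpa [hx] using e0 h j
    · exact (h i).2.imp_right fun h => by simpa [hx] using e1 h j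
  have h2 : ∀ i j, ((1 - y j : ℝ) : EReal) * elog (if x i j then 1 - p i else p i) =
      (((1 - y j) * log (if x i j then 1 - p i else p i) : ℝ) : EReal) := by
    intro i j
    apply coe_mul_elog
    obtain ⟨e0, e1⟩ := entry_eq_of_flipFrac_eq hm (r := x i) hy
    split_ifs with hx
    · refine (h i).2.imp_right fun h => ?_
      have := e1 h j
      rw [if_pos hx] at this
      linarith
    · refine (h i).1.imp_right fun h => ?_
      have := e0 h j
      rwa [if_neg hx] at this
  simp_rw [h1, h2, coe_sum_ereal, ← EReal.coe_add]
  congr 2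
  rw [← sum_add_distrib, mul_sum]
  refine sum_congr rfl fun i _ => ?_
  have e1 : m * flipFrac (x i) y = ∑ j, if x i j then y j else 1 - y j := by
    unfold flipFrac; field_simp
  have e2 : m * (1 - flipFrac (x i) y) = ∑ j, (1 - if x i j then y j else 1 - y j) := by
    rw [mul_sub, e1, sum_sub_distrib]; simp
  rw [crossLog, mul_add, ← mul_assoc, ← mul_assoc, e1, e2, sum_mul, sum_mul, ← sum_add_distrib,
    ← sum_add_distrib]
  refine sum_congr rfl fun j _ => ?_
  cases x i j
  · simp only [Bool.false_eq_true, if_false]; ring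
  · simp only [if_true]

theorem crossFinite_of_objective_ne_bot (hm : 0 < m) {x : Fin n → Fin m → Bool} {p : Fin n → ℝ}
    {y : Fin m → ℝ} (hy : ∀ j, y j ∈ Set.Icc (0 : ℝ) 1) (h : objective x p y ≠ ⊥) (i : Fin n) :
    CrossFinite (flipFrac (x i) y) (p i) := by
  have hm' : (m : ℝ) ≠ 0 := by positivity
  rw [objective_eq_sum_elog] at h
  have hA0 : ∑ i, ∑ j, (y j : EReal) * elog (if x i j then p i else 1 - p i) ≠ ⊥ :=
    fun hb => h (by rw [hb, EReal.bot_add, EReal.bot_add])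
  have hB0 : ∑ i, ∑ j, ((1 - y j : ℝ) : EReal) * elog (if x i j then 1 - p i else p i) ≠ ⊥ :=
    fun hb => h (by rw [hb, EReal.add_bot, EReal.bot_add])
  have hA := fun j => ne_bot_of_sum_ne_bot (ne_bot_of_sum_ne_bot hA0 i (mem_univ i)) j (mem_univ j)
  have hB := fun j => ne_bot_of_sum_ne_bot (ne_bot_of_sum_ne_bot hB0 i (mem_univ i)) j (mem_univ j)
  have hA' := fun j => pos_or_eq_zero_of_mul_elog_ne_bot (hy j).1 (hA j)
  have hB' := fun j => pos_or_eq_zero_of_mul_elog_ne_bot (sub_nonneg.2 (hy j).2) (hB j)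
  refine ⟨or_iff_not_imp_left.2 fun hp => ?_, or_iff_not_imp_left.2 fun hp => ?_⟩
  · rw [flipFrac, div_eq_zero_iff]
    refine Or.inl (sum_eq_zero fun j _ => ?_)
    have h1 := hA' j
    have h2 := hB' j
    split_ifs at h1 h2 ⊢
    · exact h1.resolve_left hp
    · exact h2.resolve_left hp
  · rw [flipFrac, div_eq_one_iff_eq hm', sum_congr rfl (g := fun _ => (1 : ℝ)), sum_const,
      card_univ, Fintype.card_fin, nsmul_eq_mul, mul_one]
    intro j _
    have h1 := hA' j
    have h2 := hB' j
    split_ifs at h1 h2 ⊢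
    · linarith [h2.resolve_left hp]
    · linarith [h1.resolve_left hp]

theorem objective_flipFrac (hm : 0 < m) {x : Fin n → Fin m → Bool} {y : Fin m → ℝ}
    (hy : ∀ j, y j ∈ Set.Icc (0 : ℝ) 1) :
    objective x (fun i => flipFrac (x i) y) y = (potential x y : EReal) := by
  rw [objective_eq_coe hm hy fun i => crossFinite_self (flipFrac_mem (x i) hy)]
  congr 1
  simp only [crossLog_self, sum_neg_distrib, potential]
  ring

/-- Since the constraint is strict, the abilities at a constrained maximizer maximize the
objective without a constraint: they are the agreements with the labels. -/
theorem ability_eq_flipFrac (hn : 0 < n) (hm : 0 < m) {x : Fin n → Fin m → Bool}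
    {p : Fin n → ℝ} {y : Fin m → ℝ} (hf : (p, y) ∈ feasible n m)
    (hmax : IsMaxOn (fun q : (Fin n → ℝ) × (Fin m → ℝ) => objective x q.1 q.2) (feasible n m)
      (p, y)) : p = fun i => flipFrac (x i) y := by
  have hn' : (0 : ℝ) < n := by positivity
  have hm' : (0 : ℝ) < m := by positivity
  obtain ⟨hp, hy, hmean⟩ := hf
  simp only at hp hy hmean
  have hne : objective x p y ≠ ⊥ := by
    have hmem : ((fun _ => 2 / 3, y) : (Fin n → ℝ) × (Fin m → ℝ)) ∈ feasible n m := by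
      refine ⟨fun _ => by norm_num, hy, ?_⟩
      simp only [sum_const, card_univ, Fintype.card_fin, nsmul_eq_mul]
      rw [lt_div_iff₀ hn']; linarith
    have h := hmax hmem
    simp only [Set.mem_ofPred_eq] at h
    rw [objective_eq_coe hm hy fun i => ⟨Or.inl (by norm_num), Or.inl (by norm_num)⟩] at h
    intro hb
    rw [hb] at h
    exact EReal.coe_ne_bot _ (le_bot_iff.1 h)
  have hfin := crossFinite_of_objective_ne_bot hm hy hne
  have ha := fun i => flipFrac_mem (x i) hy
  obtain ⟨t, ht0, ht1, htm⟩ : ∃ t : ℝ, 0 < t ∧ t < 1 ∧ 1 / 2 < (1 - t) * ((∑ i, p i) / n) := by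
    set M := (∑ i, p i) / n
    refine ⟨(M - 1 / 2) / (2 * M), by apply div_pos <;> linarith, ?_, ?_⟩
    · rw [div_lt_one (by linarith)]; linarith
    · have hM : (0 : ℝ) < M := by linarith
      have : (1 - (M - 1 / 2) / (2 * M)) * M = M - (M - 1 / 2) / 2 := by field_simp
      linarith
  have hmem : ((fun i => (1 - t) * p i + t * flipFrac (x i) y, y) : (Fin n → ℝ) × (Fin m → ℝ)) ∈
      feasible n m := by
    refine ⟨fun i => ⟨?_, ?_⟩, hy, ?_⟩
    · have := mul_nonneg (sub_nonneg.2 ht1.le) (hp i).1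
      have := mul_nonneg ht0.le (ha i).1
      simp only; linarith
    · have := mul_le_mul_of_nonneg_left (hp i).2 (sub_nonneg.2 ht1.le)
      have := mul_le_mul_of_nonneg_left (ha i).2 ht0.le
      simp only; linarith
    · simp only [sum_add_distrib, ← mul_sum, add_div, mul_div_assoc]
      have : 0 ≤ t * ((∑ i, flipFrac (x i) y) / n) :=
        mul_nonneg ht0.le (div_nonneg (sum_nonneg fun i _ => (ha i).1) hn'.le)
      linarith
  have hle := hmax hmem
  simp only [Set.mem_ofPred_eq] at hle
  rw [objective_eq_coe hm hy hfin, objective_eq_coe hm hy fun i =>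
    crossFinite_convexComb (ha i) (hfin i) ht0.le ht1, EReal.coe_le_coe_iff,
    add_le_add_iff_right] at hle
  have hle' := le_of_mul_le_mul_left hle hm'
  by_contra hne'
  obtain ⟨k, hk⟩ := Function.ne_iff.1 hne'
  have hlt : ∑ i, crossLog (flipFrac (x i) y) (p i) <
      ∑ i, crossLog (flipFrac (x i) y) (flipFrac (x i) y) := by
    refine sum_lt_sum (fun i _ => ?_) ⟨k, mem_univ k, crossLog_lt_self (ha k) (hp k) (hfin k) hk⟩
    rcases eq_or_ne (p i) (flipFrac (x i) y) with h | h
    · rw [h]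
    · exact (crossLog_lt_self (ha i) (hp i) (hfin i) h).le
  have hconv := sum_le_sum fun i (_ : i ∈ univ) =>
    crossLog_convexComb_ge (ha i) (hfin i) ht0.le ht1.le
  rw [sum_add_distrib, ← mul_sum, ← mul_sum] at hconv
  nlinarith

theorem continuous_potential (x : Fin n → Fin m → Bool) : Continuous (potential x) := by
  unfold potential flipFrac
  refine Continuous.sub (continuous_finsetSum _ fun j _ =>
    binEntropy_continuous.comp (continuous_apply j)) (continuous_const.mul
    (continuous_finsetSum _ fun i _ => binEntropy_continuous.comp (Continuous.div_const
      (continuous_finsetSum _ fun j _ => ?_) _)))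
  split_ifs
  · exact continuous_apply j
  · exact continuous_const.sub (continuous_apply j)

/-- The label part of a constrained maximizer is an unconstrained maximizer of the potential: a
competitor that violates the constraint strictly satisfies it after swapping the two labels, and
one with mean ability `1 / 2` is a limit of feasible ones. -/
theorem IsConstrainedEstimator.isPotentialMax (hn : 0 < n) (hm : 0 < m)
    {x : Fin n → Fin m → Bool} {y : Fin m → ℝ} (h : IsConstrainedEstimator x y) :
    IsPotentialMax x y ∧ (n : ℝ) / 2 < ∑ i, flipFrac (x i) y := by
  have hn' : (0 : ℝ) < n := by positivity
  obtain ⟨p, hf, hmax⟩ := h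
  obtain rfl := ability_eq_flipFrac hn hm hf hmax
  obtain ⟨-, hy, hmean⟩ := hf
  simp only at hy hmean
  rw [lt_div_iff₀ hn'] at hmean
  have hfeas : ∀ y' : Fin m → ℝ, (∀ j, y' j ∈ Set.Icc (0 : ℝ) 1) →
      (n : ℝ) / 2 < ∑ i, flipFrac (x i) y' → potential x y' ≤ potential x y := by
    intro y' hy' hy'm
    have hle := hmax (show ((fun i => flipFrac (x i) y', y') : (Fin n → ℝ) × (Fin m → ℝ)) ∈
      feasible n m from ⟨fun i => flipFrac_mem (x i) hy', hy', by
        simp only; rw [lt_div_iff₀ hn']; linarith⟩)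
    simp only [Set.mem_ofPred_eq] at hle
    rwa [objective_flipFrac hm hy, objective_flipFrac hm hy', EReal.coe_le_coe_iff] at hle
  refine ⟨⟨hy, fun y' hy' => ?_⟩, by linarith⟩
  rcases lt_trichotomy ((n : ℝ) / 2) (∑ i, flipFrac (x i) y') with hlt | heq | hgt
  · exact hfeas y' hy' hlt
  · have hlin : ∀ t : ℝ, ∀ r : Fin m → Bool, flipFrac r (fun j => (1 - t) * y' j + t * y j) =
        (1 - t) * flipFrac r y' + t * flipFrac r y := by
      intro t r
      unfold flipFrac
      rw [mul_div_assoc', mul_div_assoc', ← add_div, mul_sum, mul_sum, ← sum_add_distrib]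
      congr 1; refine sum_congr rfl fun j _ => ?_
      split_ifs <;> ring
    have hcont : Filter.Tendsto (fun t : ℝ => potential x (fun j => (1 - t) * y' j + t * y j))
        (nhdsWithin 0 (Set.Ioi 0)) (nhds (potential x y')) := by
      have hc : Continuous fun t : ℝ => potential x (fun j => (1 - t) * y' j + t * y j) :=
        (continuous_potential x).comp (continuous_pi fun j => by fun_prop)
      have := hc.tendsto 0
      simp only [sub_zero, one_mul, zero_mul, add_zero] at this
      exact this.mono_left nhdsWithin_le_nhds
    refine le_of_tendsto hcont ?_
    filter_upwards [Ioc_mem_nhdsGT (zero_lt_one' ℝ)] with t ht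
    refine hfeas _ (fun j => ⟨?_, ?_⟩) ?_
    · have := mul_nonneg (sub_nonneg.2 ht.2) (hy' j).1
      have := mul_nonneg ht.1.le (hy j).1
      linarith
    · have := mul_le_mul_of_nonneg_left (hy' j).2 (sub_nonneg.2 ht.2)
      have := mul_le_mul_of_nonneg_left (hy j).2 ht.1.le
      linarith
    · simp_rw [hlin, sum_add_distrib, ← mul_sum, ← heq]
      nlinarith [ht.1]
  · rw [← potential_one_sub hm]
    refine hfeas _ (fun j => ⟨sub_nonneg.2 (hy' j).2, by linarith [(hy' j).1]⟩) ?_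
    simp only [flipFrac_one_sub hm, sum_sub_distrib]
    simp only [sum_const, card_univ, Fintype.card_fin, nsmul_eq_mul, mul_one]
    linarith

/-- Correctness of the answers `x` for the true labels `y`, where the answers of the workers
selected by `f` are reversed. -/
def correctness (x : Fin n → Fin m → Bool) (y : Fin m → Bool) (f : Fin n → Bool) :
    Fin n → Fin m → Bool := fun i j => xor (x i j == y j) (f i)

theorem flipFrac_correctness (hm : 0 < m) (x : Fin n → Fin m → Bool) (y : Fin m → Bool)
    (f : Fin n → Bool) (u : Fin m → ℝ) (i : Fin n) :
    flipFrac (correctness x y f i) (fun j => if y j then 1 - u j else u j) =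
      if f i then flipFrac (x i) u else 1 - flipFrac (x i) u := by
  rw [← flipFrac_one_sub hm]
  unfold flipFrac correctness
  split_ifs with hf
  · congr 1; refine sum_congr rfl fun j _ => ?_
    cases x i j <;> cases hy : y j <;> simp [hf, hy]
  · congr 1; refine sum_congr rfl fun j _ => ?_
    cases x i j <;> cases hy : y j <;> simp [hf, hy]

theorem potential_correctness (hm : 0 < m) (x : Fin n → Fin m → Bool) (y : Fin m → Bool)
    (f : Fin n → Bool) (u : Fin m → ℝ) :
    potential (correctness x y f) (fun j => if y j then 1 - u j else u j) = potential x u := by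
  unfold potential
  simp_rw [flipFrac_correctness hm]
  congr 1
  · refine sum_congr rfl fun j _ => ?_
    split_ifs <;> simp
  · congr 1; refine sum_congr rfl fun i _ => ?_
    split_ifs <;> simp

/-- In terms of correctness and label errors, a constrained estimator is a maximizer of the
potential, and the constraint bounds its signed agreement with the workers. -/
theorem IsConstrainedEstimator.correctness (hn : 0 < n) (hm : 0 < m)
    {x : Fin n → Fin m → Bool} {u : Fin m → ℝ} (h : IsConstrainedEstimator x u)
    (y : Fin m → Bool) (f : Fin n → Bool) :
    IsPotentialMax (correctness x y f) (fun j => if y j then 1 - u j else u j) ∧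
      labelingError u y = (∑ j, if y j then 1 - u j else u j) / m ∧
      0 < ∑ i, (if f i then -1 else 1) * (1 - 2 * flipFrac (DawidSkene.correctness x y f i)
        (fun j => if y j then 1 - u j else u j)) := by
  obtain ⟨⟨hu, hmax⟩, hmean⟩ := h.isPotentialMax hn hm
  refine ⟨⟨fun j => ?_, fun e' he' => ?_⟩, ?_, ?_⟩
  · split_ifs
    exacts [⟨sub_nonneg.2 (hu j).2, by linarith [(hu j).1]⟩, hu j]
  · have e : e' = fun j => if y j then 1 - (if y j then 1 - e' j else e' j) else
        (if y j then 1 - e' j else e' j) := by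
      ext j; split_ifs <;> ring
    rw [e, potential_correctness hm, potential_correctness hm]
    refine hmax _ fun j => ?_
    split_ifs
    exacts [⟨sub_nonneg.2 (he' j).2, by linarith [(he' j).1]⟩, he' j]
  · unfold labelingError
    congr 1; refine sum_congr rfl fun j _ => ?_
    unfold label
    split_ifs
    · rw [abs_sub_comm, abs_of_nonneg (sub_nonneg.2 (hu j).2)]
    · rw [sub_zero, abs_of_nonneg (hu j).1]
  · have e : ∀ i, ((if f i then -1 else 1) * (1 - 2 * flipFrac (DawidSkene.correctness x y f i)
        (fun j => if y j then 1 - u j else u j)) : ℝ) = 2 * flipFrac (x i) u - 1 := by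
      intro i
      rw [flipFrac_correctness hm]
      split_ifs <;> ring
    rw [sum_congr rfl fun i _ => e i, sum_sub_distrib, ← mul_sum]
    simp only [sum_const, card_univ, Fintype.card_fin, nsmul_eq_mul, mul_one]
    linarith

end Estimator

/-! ### Rates and transfer to the model -/

theorem meanErrFactor_le_exp {q : ℝ} (hq : q ∈ Set.Icc (0 : ℝ) (1 / 2)) :
    meanErrFactor (1 / 300) q ≤ exp (-(1 - 2 * q) ^ 2 / 2) := by
  unfold meanErrFactor
  split_ifs with h
  · have h1 : √(q + 1 / 300) ≤ exp (-(3 / 2)) := by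
      rw [sqrt_le_left (exp_pos _).le, ← exp_nat_mul,
        show ((2 : ℕ) : ℝ) * -(3 / 2) = -3 by norm_num, exp_neg,
        le_inv_comm₀ (by linarith [hq.1]) (exp_pos _)]
      have e : exp 3 = exp 1 ^ 3 := by rw [← exp_nat_mul]; norm_num
      have h2 : exp 1 ^ 3 ≤ 2.7183 ^ 3 :=
        pow_le_pow_left₀ (exp_pos _).le (by linarith [exp_one_lt_d9]) 3
      have h3 : (23 : ℝ) ≤ (q + 1 / 300)⁻¹ := by
        rw [le_inv_comm₀ (by norm_num) (by linarith [hq.1])]; norm_num; linarith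
      rw [e]; norm_num at h2; linarith
    calc exp 1 * √(q + 1 / 300) ≤ exp 1 * exp (-(3 / 2)) :=
          mul_le_mul_of_nonneg_left h1 (exp_pos _).le
      _ = exp (-(1 / 2)) := by rw [← exp_add]; norm_num
      _ ≤ _ := exp_le_exp.2 (by nlinarith [hq.1, hq.2])
  · have e : 2 * √(q * (1 - q)) = √(1 - (1 - 2 * q) ^ 2) := by
      rw [show (1 : ℝ) - (1 - 2 * q) ^ 2 = 2 ^ 2 * (q * (1 - q)) by ring,
        sqrt_mul (by norm_num) (q * (1 - q)),
        sqrt_sq (by norm_num)]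
    rw [e, sqrt_le_left (exp_pos _).le, ← exp_nat_mul]
    have := add_one_le_exp (-(1 - 2 * q) ^ 2)
    have e2 : ((2 : ℕ) : ℝ) * (-(1 - 2 * q) ^ 2 / 2) = -(1 - 2 * q) ^ 2 := by push_cast; ring
    rw [e2]; linarith

theorem meanErrFactor_nonneg (ρ q : ℝ) : 0 ≤ meanErrFactor ρ q := by
  unfold meanErrFactor; split_ifs <;> positivity

theorem meanErrFactor_le_mul_sqrt {ρ q : ℝ} (hρ : 0 ≤ ρ) (hq : 0 ≤ q) :
    meanErrFactor ρ q ≤ exp 1 * √(q + ρ) := by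
  unfold meanErrFactor
  split_ifs
  · exact le_rfl
  · have h1 : √(q * (1 - q)) ≤ √(q + ρ) := sqrt_le_sqrt (by nlinarith)
    have h2 : (2 : ℝ) ≤ exp 1 := by linarith [add_one_le_exp (1 : ℝ)]
    exact mul_le_mul h2 h1 (sqrt_nonneg _) (exp_pos _).le

/-- An arithmetic-geometric mean bound for the product of the factors. -/
theorem prod_meanErrFactor_le {n : ℕ} {q : Fin n → ℝ}
    (hq : ∀ i, q i ∈ Set.Icc (0 : ℝ) (1 / 2)) {ρ a : ℝ} (hρ : 0 ≤ ρ) (ha : 0 < a)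
    (hsum : ∑ i, q i = n * (a - ρ)) :
    ∏ i, meanErrFactor ρ (q i) ≤ exp (n + n / 2 * log a) := by
  have hone : ∀ i, meanErrFactor ρ (q i) ≤ exp (1 + log a / 2 + ((q i + ρ) / a - 1) / 2) := by
    intro i
    refine (meanErrFactor_le_mul_sqrt hρ (hq i).1).trans ?_
    rw [add_assoc, exp_add]
    refine mul_le_mul_of_nonneg_left ?_ (exp_pos _).le
    rw [sqrt_le_left (exp_pos _).le, ← exp_nat_mul]
    have e : ((2 : ℕ) : ℝ) * (log a / 2 + ((q i + ρ) / a - 1) / 2) =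
        log a + ((q i + ρ) / a - 1) := by push_cast; ring
    rw [e, exp_add, exp_log ha]
    have h := add_one_le_exp ((q i + ρ) / a - 1)
    have h2 := mul_le_mul_of_nonneg_left h ha.le
    have e2 : a * ((q i + ρ) / a - 1 + 1) = q i + ρ := by field_simp; ring
    linarith
  refine (prod_le_prod (fun i _ => meanErrFactor_nonneg _ _) fun i _ => hone i).trans_eq ?_
  rw [← exp_sum]
  congr 1
  have e3 : ∑ i, ((q i + ρ) / a - 1) / 2 = 0 := by
    rw [← sum_div, sum_sub_distrib, ← sum_div, sum_add_distrib, hsum]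
    simp
    field_simp; ring
  rw [sum_add_distrib, e3]
  simp
  ring

/-- The power series of `log ((1 + d) / (1 - d))` has nonnegative coefficients, so the function
lies below its chord on `[0, 6 / 7]`. -/
theorem log_div_le_three_mul {d : ℝ} (hd0 : 0 ≤ d) (hd : d ≤ 6 / 7) :
    log ((1 + d) / (1 - d)) ≤ 3 * d := by
  have h1 := hasSum_log_sub_log_of_abs_lt_one (x := d) (by rw [abs_of_nonneg hd0]; linarith)
  have h2 := (hasSum_log_sub_log_of_abs_lt_one (x := 6 / 7) (by rw [abs_lt]; norm_num)).mul_left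
    (7 / 6 * d)
  have h3 := hasSum_le (fun k => ?_) h1 h2
  · have e : log (1 + 6 / 7) - log (1 - 6 / 7) = log 13 := by
      rw [← log_div (by norm_num) (by norm_num)]; norm_num
    have hlog : 7 * log 13 ≤ 18 := by
      have h4 : log ((13 : ℝ) ^ 7) ≤ 18 := by
        rw [log_le_iff_le_exp (by norm_num)]
        have e1 : exp 18 = exp 1 ^ 18 := by rw [← exp_nat_mul]; norm_num
        have e2 : (2.7182 : ℝ) ^ 18 ≤ exp 1 ^ 18 :=
          pow_le_pow_left₀ (by norm_num) (by linarith [exp_one_gt_d9]) 18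
        rw [e1]; norm_num at e2 ⊢; linarith
      rw [log_pow] at h4
      exact_mod_cast h4
    rw [e] at h3
    rw [log_div (by linarith) (by linarith)]
    nlinarith
  · have hpow : d ^ (2 * k + 1) ≤ 7 / 6 * d * (6 / 7) ^ (2 * k + 1) := by
      rw [pow_succ, pow_succ]
      have := pow_le_pow_left₀ hd0 hd (2 * k)
      nlinarith
    have hk : (0 : ℝ) ≤ 2 * (1 / (2 * k + 1)) := by positivity
    nlinarith [mul_le_mul_of_nonneg_left hpow hk]

/-- The exponent arithmetic behind the divergence rate: `q` is the average error probability, `d`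
its divergence, `K` the collective wisdom, and `exp (-K / 8)` the a priori bound on the error. -/
theorem exponent_le {n q d K : ℝ} (hn : 0 < n) (hq0 : 0 < q) (hq1 : q ≤ 1 / 2)
    (hd : d = (1 - 2 * q) * log ((1 - q) / q)) (hKn : K ≤ n) (hKd : 3 * K < n * d)
    (hqK : n * (1 - 2 * q) ^ 2 ≤ K) (hlog : log (4 / q) < K) (hK : 1000 ≤ K) :
    n + n / 2 * log (q + exp (-K / 8)) ≤ -(n * d / 24) - K / 4 := by
  have hd3 : 3 * (1 - 2 * q) ^ 2 < d := by
    have : n * (3 * (1 - 2 * q) ^ 2) < n * d := by linarith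
    exact lt_of_mul_lt_mul_left this hn.le
  have hq14 : q < 1 / 14 := by
    by_contra! hcon
    have h := log_div_le_three_mul (d := 1 - 2 * q) (by linarith) (by linarith)
    have e : (1 + (1 - 2 * q)) / (1 - (1 - 2 * q)) = (1 - q) / q := by field_simp; ring
    rw [e] at h
    nlinarith
  set L := -log q with hL
  have hdL : d ≤ (1 - 2 * q) * L := by
    rw [hd, log_div (by linarith) hq0.ne']
    have : log (1 - q) ≤ 0 := log_nonpos (by linarith) (by linarith)
    nlinarith
  set ρ := exp (-K / 8) with hρ
  have hρ0 : 0 < ρ := exp_pos _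
  rcases le_or_gt (100 * ρ) q with hc | hc
  · have h1 : log (q + ρ) ≤ -L + 1 / 100 := by
      have : log (q + ρ) ≤ log (q * exp (1 / 100)) := by
        apply log_le_log (by linarith)
        have := add_one_le_exp (1 / 100 : ℝ)
        nlinarith
      rw [log_mul hq0.ne' (exp_pos _).ne', log_exp] at this
      linarith
    have h2 : 1.005 ≤ L * (3 / 8 + q / 4) := by
      have hinv : L = log q⁻¹ := by rw [log_inv]
      rcases le_or_gt (6 / 100) q with h6 | h6
      · have : 13 / 5 ≤ L := by
          rw [hinv, le_log_iff_exp_le (by positivity)]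
          refine le_trans ?_ (show (14 : ℝ) ≤ q⁻¹ by
            rw [le_inv_comm₀ (by norm_num) hq0]; linarith)
          refine le_of_pow_le_pow_left₀ (n := 5) (by norm_num) (by norm_num) ?_
          have e1 : exp (13 / 5) ^ 5 = exp 1 ^ 13 := by
            rw [← exp_nat_mul, ← exp_nat_mul]; norm_num
          have e2 : exp 1 ^ 13 ≤ (2.7183 : ℝ) ^ 13 :=
            pow_le_pow_left₀ (exp_pos _).le (by linarith [exp_one_lt_d9]) 13
          rw [e1]; norm_num at e2 ⊢; linarith
        nlinarith
      · have : 27 / 10 ≤ L := by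
          rw [hinv, le_log_iff_exp_le (by positivity)]
          refine le_trans ?_ (show (16 : ℝ) ≤ q⁻¹ by
            rw [le_inv_comm₀ (by norm_num) hq0]; linarith)
          refine le_of_pow_le_pow_left₀ (n := 10) (by norm_num) (by norm_num) ?_
          have e1 : exp (27 / 10) ^ 10 = exp 1 ^ 27 := by
            rw [← exp_nat_mul, ← exp_nat_mul]; norm_num
          have e2 : exp 1 ^ 27 ≤ (2.7183 : ℝ) ^ 27 :=
            pow_le_pow_left₀ (exp_pos _).le (by linarith [exp_one_lt_d9]) 27
          rw [e1]; norm_num at e2 ⊢; linarith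
        nlinarith
    have h3 : n / 2 * log (q + ρ) ≤ n / 2 * (-L + 1 / 100) :=
      mul_le_mul_of_nonneg_left h1 (by linarith)
    have h4 : n * d / 24 + n * d / 12 ≤ n * ((1 - 2 * q) * L) / 8 := by
      have := mul_le_mul_of_nonneg_left hdL hn.le
      linarith
    have h5 := mul_le_mul_of_nonneg_left h2 hn.le
    nlinarith
  · have h1 : log (q + ρ) ≤ 5 - K / 8 := by
      have h2 : log (q + ρ) ≤ log (101 * ρ) := log_le_log (by linarith) (by linarith)
      rw [log_mul (by norm_num) hρ0.ne', hρ, log_exp] at h2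
      have h3 : log (101 : ℝ) ≤ 5 := by
        rw [log_le_iff_le_exp (by norm_num)]
        have e1 : exp 5 = exp 1 ^ 5 := by rw [← exp_nat_mul]; norm_num
        have e2 : (2.7182 : ℝ) ^ 5 ≤ exp 1 ^ 5 :=
          pow_le_pow_left₀ (by norm_num) (by linarith [exp_one_gt_d9]) 5
        rw [e1]; norm_num at e2 ⊢; linarith
      linarith
    have h2 : d ≤ K := by
      rw [log_div (by norm_num) hq0.ne'] at hlog
      have h3 : 0 ≤ log (4 : ℝ) := log_nonneg (by norm_num)
      have h4 : 0 ≤ L := by rw [hL]; linarith [log_nonpos hq0.le (by linarith : q ≤ 1)]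
      nlinarith
    have h3 : n / 2 * log (q + ρ) ≤ n / 2 * (5 - K / 8) :=
      mul_le_mul_of_nonneg_left h1 (by linarith)
    have h4 := mul_le_mul_of_nonneg_left h2 hn.le
    nlinarith

section Main

variable {n m : ℕ}

/-- On the good event the label error has the rate of the collective wisdom: the constraint on the
mean ability excludes the maximizers that are close to the opposite of the truth. -/
theorem IsPotentialMax.mean_le_exp (hn : 0 < n) (hm : 0 < m) {q σ : Fin n → ℝ}
    (hq : ∀ i, q i ∈ Set.Icc (0 : ℝ) (1 / 2)) (hσ : ∀ i, |σ i| = 1)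
    {K : ℝ} (hKdef : K = ∑ i, (1 - 2 * q i) ^ 2) (hK : 2 * 10 ^ 10 ≤ K) (hlog : 4 ≤ log (m : ℝ))
    (hKlog : log (m : ℝ) + log n ≤ K / 4)
    (hbias : 4 * (n * √(log m / (n * m))) ≤ ∑ i, σ i * (1 - 2 * q i))
    {z : Fin n → Fin m → Bool} (hz : SpreadDeviations q z) (hz' : RatesClose q z)
    (hagg : ∑ i, ∑ j, σ i * errDev (q i) (z i j) ≤ 3 / 2 * √(n * m * log m))
    (havg : avgErrFactor (1 / 300) q z ≤ exp (-(K / 8) - (1121 + 35 * (1 / 300) * K)))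
    {e : Fin m → ℝ} (h : IsPotentialMax z e)
    (hsign : 0 < ∑ i, σ i * (1 - 2 * flipFrac (z i) e)) :
    (∑ j, e j) / m ≤ exp (-(K / 8)) := by
  have hm' : (0 : ℝ) < m := by positivity
  have hn' : (0 : ℝ) < n := by positivity
  have hbound : ∀ e : Fin m → ℝ, IsPotentialMax z e → (∑ j, e j) / m ≤ 1 / 300 →
      (∑ j, e j) / m ≤ exp (-(K / 8)) := by
    intro e he hmean
    refine (he.mean_le hm (by norm_num) le_rfl hq hz hz' hmean).trans ?_
    rw [← hKdef]
    refine (mul_le_mul_of_nonneg_left havg (exp_pos _).le).trans_eq ?_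
    rw [← exp_add]; congr 1; ring
  rcases h.mean_dichotomy hm hz (hKdef ▸ hK) with hlo | hhi
  · exact hbound e h hlo
  -- near the opposite of the truth the agreement with the workers would be negative in the mean
  exfalso
  set e' : Fin m → ℝ := fun j => 1 - e j with he'
  have hmax' : IsPotentialMax z e' := h.one_sub hm
  have hmean' : (∑ j, e' j) / m = 1 - (∑ j, e j) / m := by
    simp only [he', sum_sub_distrib, sub_div]
    simp [hm'.ne']
  have hsmall := hbound e' hmax' (by rw [hmean']; linarith)
  set s := √(log m / (n * m)) with hs
  have hs0 : 0 ≤ s := sqrt_nonneg _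
  have hexp : exp (-(K / 8)) ≤ s / 2 := by
    rw [← abs_of_nonneg (show 0 ≤ s / 2 by positivity), ← abs_of_nonneg (exp_pos (-(K / 8))).le]
    rw [← sq_le_sq, div_pow, hs, sq_sqrt (by positivity), ← exp_nat_mul]
    have h1 : exp (((2 : ℕ) : ℝ) * -(K / 8)) ≤ exp (-(log (m : ℝ) + log n)) :=
      exp_le_exp.2 (by push_cast; linarith)
    refine h1.trans ?_
    rw [exp_neg, exp_add, exp_log hm', exp_log hn', div_div, inv_eq_one_div,
      div_le_div_iff₀ (by positivity) (by positivity)]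
    have : 0 < (n : ℝ) * m := by positivity
    nlinarith
  have hsqrt : √(n * m * log m) = n * m * s := by
    rw [hs, ← sqrt_sq (show (0 : ℝ) ≤ n * m by positivity), ← sqrt_mul (by positivity),
      sqrt_sq (by positivity)]
    congr 1; field_simp
  rw [hsqrt] at hagg
  have hrow : ∀ i, σ i * (1 - 2 * flipFrac (z i) e) ≤
      -(σ i * (1 - 2 * q i)) + 2 / m * (∑ j, σ i * errDev (q i) (z i j)) +
        2 * ((∑ j, e' j) / m) := by
    intro i
    have h1 : flipFrac (z i) e = 1 - flipFrac (z i) e' := by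
      rw [he', flipFrac_one_sub hm]; ring
    have h2 := wrongFrac_sub hm (q i) (z i)
    have h3 : |(∑ j, e' j * sgn (z i j))| ≤ ∑ j, e' j := by
      refine (abs_sum_le_sum_abs _ _).trans (sum_le_sum fun j _ => ?_)
      rw [abs_mul, abs_sgn, mul_one, abs_of_nonneg (hmax'.mem j).1]
    have h4 : σ i * ((∑ j, e' j * sgn (z i j)) / m) ≤ (∑ j, e' j) / m := by
      refine (le_abs_self _).trans ?_
      rw [abs_mul, hσ i, one_mul, abs_div, abs_of_pos hm']
      exact div_le_div_of_nonneg_right h3 hm'.le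
    rw [h1, flipFrac_eq, ← mul_sum]
    have h5 : wrongFrac (z i) = q i + (∑ j, errDev (q i) (z i j)) / m := by linarith
    rw [h5]
    have e1 : σ i * (1 - 2 * (1 - (q i + (∑ j, errDev (q i) (z i j)) / m +
        (∑ j, e' j * sgn (z i j)) / m))) = -(σ i * (1 - 2 * q i)) +
        2 / m * (σ i * ∑ j, errDev (q i) (z i j)) + 2 * (σ i * ((∑ j, e' j * sgn (z i j)) / m)) := by
      ring
    linarith
  have htot := sum_le_sum fun i (_ : i ∈ univ) => hrow i
  rw [sum_add_distrib, sum_add_distrib, sum_neg_distrib, ← mul_sum] at htot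
  simp only [sum_const, card_univ, Fintype.card_fin, nsmul_eq_mul] at htot
  have h6 : 2 / (m : ℝ) * ∑ i, ∑ j, σ i * errDev (q i) (z i j) ≤ 3 * (n * s) := by
    refine (mul_le_mul_of_nonneg_left hagg (by positivity)).trans_eq ?_
    field_simp
  have h7 : (n : ℝ) * (2 * ((∑ j, e' j) / m)) ≤ n * s := by
    apply mul_le_mul_of_nonneg_left _ hn'.le
    linarith
  linarith

theorem matrixProb_avgErrFactor_le (hm : 0 < m) {q : Fin n → ℝ} {ρ c t : ℝ}
    (hq : ∀ i, q i ∈ Set.Icc (0 : ℝ) 1) (hρ : 0 ≤ ρ)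
    (hc : ∏ i, meanErrFactor ρ (q i) ≤ exp c) :
    matrixProb q {z : Fin n → Fin m → Bool | exp t < avgErrFactor ρ q z} ≤ exp (c - t) := by
  rw [exp_sub]
  exact matrixProb_le_div hq (avgErrFactor_nonneg ρ q) (exp_pos t)
    ((sum_matrixWeight_mul_avgErrFactor_le hm hq hρ).trans hc) fun z hz => le_of_lt hz

theorem matrixProb_avgErrFactor_const_le (hm : 0 < m) {q : Fin n → ℝ}
    (hq : ∀ i, q i ∈ Set.Icc (0 : ℝ) (1 / 2))
    {K : ℝ} (hKdef : K = ∑ i, (1 - 2 * q i) ^ 2) (hK : 2 * 10 ^ 10 ≤ K)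
    (hKlog : log (m : ℝ) + log n ≤ K / 4) :
    matrixProb q {z : Fin n → Fin m → Bool | exp (-(K / 8) - (1121 + 35 * (1 / 300) * K)) <
      avgErrFactor (1 / 300) q z} ≤ exp 1121 / m := by
  have hm' : (0 : ℝ) < m := by positivity
  have hq' : ∀ i, q i ∈ Set.Icc (0 : ℝ) 1 := fun i => ⟨(hq i).1, by linarith [(hq i).2]⟩
  have hprod : ∏ i, meanErrFactor (1 / 300) (q i) ≤ exp (-K / 2) := by
    refine (prod_le_prod (fun i _ => meanErrFactor_nonneg _ _)
      fun i _ => meanErrFactor_le_exp (hq i)).trans_eq ?_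
    rw [← exp_sum, ← sum_div, sum_neg_distrib, hKdef]
  refine (matrixProb_avgErrFactor_le hm hq' (by norm_num) hprod).trans ?_
  have hn0 : 0 ≤ log (n : ℝ) := log_natCast_nonneg n
  have e : exp 1121 / (m : ℝ) = exp (1121 - log m) := by rw [exp_sub, exp_log hm']
  rw [e]
  exact exp_le_exp.2 (by linarith)

theorem effAbility_mem {p : ℝ} (hp : p ∈ Set.Icc (0 : ℝ) 1) :
    1 - effAbility p ∈ Set.Icc (0 : ℝ) (1 / 2) := by
  unfold effAbility
  split_ifs with h
  · exact ⟨by linarith [hp.2], by linarith⟩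
  · exact ⟨by linarith [hp.1], by linarith⟩

/-- Correctness of the answers up to the reversal of the answers of workers with ability below
`1 / 2` has a product law. -/
theorem IsOneCoinModel.measureReal_correctness_eq {Ω : Type*} [MeasurableSpace Ω] {P : Measure Ω}
    [IsProbabilityMeasure P] {p : Fin n → ℝ} {y : Fin m → Bool} {X : Fin n → Fin m → Ω → Bool}
    (h : IsOneCoinModel P p y X) (z : Fin n → Fin m → Bool) :
    P.real {ω | correctness (fun i j => X i j ω) y (fun i => decide (p i < 1 / 2)) = z} =
      matrixWeight (fun i => 1 - effAbility (p i)) z := by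
  let S : Fin n × Fin m → Set Bool :=
    fun ij => {b | xor (b == y ij.2) (decide (p ij.1 < 1 / 2)) = z ij.1 ij.2}
  have hset : {ω | correctness (fun i j => X i j ω) y (fun i => decide (p i < 1 / 2)) = z} =
      ⋂ ij ∈ (univ : Finset (Fin n × Fin m)), (fun ω => X ij.1 ij.2 ω) ⁻¹' S ij := by
    ext ω
    simp only [correctness, S, funext_iff, Set.mem_ofPred_eq, mem_univ, Set.iInter_true,
      Set.mem_iInter, Set.mem_preimage, Prod.forall]
  rw [hset, Measure.real,
    h.indep.measure_inter_preimage_eq_mul _ (fun _ _ => MeasurableSet.of_discrete),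
    ENNReal.toReal_prod]
  unfold matrixWeight rowWeight
  rw [Fintype.prod_prod_type]
  refine prod_congr rfl fun i _ => prod_congr rfl fun j _ => ?_
  change P.real (X i j ⁻¹' S (i, j)) = _
  have hc := h.prob_correct i j
  have hmeas : MeasurableSet {ω | X i j ω = y j} := h.measurable i j (measurableSet_singleton (y j))
  have hnc : P.real {ω | X i j ω ≠ y j} = 1 - p i := by
    rw [← hc, ← probReal_compl_eq_one_sub hmeas]; rfl
  by_cases hp : p i < 1 / 2
  · have heff : effAbility (p i) = 1 - p i := if_neg (not_le.2 hp)
    have hd : decide (p i < 1 / 2) = true := decide_eq_true hp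
    cases hz : z i j
    · have : X i j ⁻¹' S (i, j) = {ω | X i j ω = y j} := by
        ext ω
        simp only [S, Set.mem_preimage, Set.mem_ofPred_eq, hz, hd]
        cases X i j ω <;> cases y j <;> simp
      rw [this, hc]; simp [answerWeight, heff]
    · have : X i j ⁻¹' S (i, j) = {ω | X i j ω ≠ y j} := by
        ext ω
        simp only [S, Set.mem_preimage, Set.mem_ofPred_eq, hz, hd]
        cases X i j ω <;> cases y j <;> simp
      rw [this, hnc]; simp [answerWeight, heff]
  · have heff : effAbility (p i) = p i := if_pos (not_lt.1 hp)
    have hd : decide (p i < 1 / 2) = false := decide_eq_false hp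
    cases hz : z i j
    · have : X i j ⁻¹' S (i, j) = {ω | X i j ω ≠ y j} := by
        ext ω
        simp only [S, Set.mem_preimage, Set.mem_ofPred_eq, hz, hd]
        cases X i j ω <;> cases y j <;> simp
      rw [this, hnc]; simp [answerWeight, heff]
    · have : X i j ⁻¹' S (i, j) = {ω | X i j ω = y j} := by
        ext ω
        simp only [S, Set.mem_preimage, Set.mem_ofPred_eq, hz, hd]
        cases X i j ω <;> cases y j <;> simp
      rw [this, hc]; simp [answerWeight, heff]

/-- An event that holds unless the correctness matrix is in a set `A` has probability at least
`1 - matrixProb A`. -/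
theorem IsOneCoinModel.one_sub_le_measureReal {Ω : Type*} [MeasurableSpace Ω] {P : Measure Ω}
    [IsProbabilityMeasure P] {p : Fin n → ℝ} {y : Fin m → Bool} {X : Fin n → Fin m → Ω → Bool}
    (h : IsOneCoinModel P p y X) {A : Set (Fin n → Fin m → Bool)} {c : ℝ}
    (hA : matrixProb (fun i => 1 - effAbility (p i)) A ≤ c) {T : Set Ω}
    (hT : ∀ ω, correctness (fun i j => X i j ω) y (fun i => decide (p i < 1 / 2)) ∉ A → ω ∈ T) :
    1 - c ≤ P.real T := by
  classical
  let Z : Ω → Fin n → Fin m → Bool :=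
    fun ω => correctness (fun i j => X i j ω) y (fun i => decide (p i < 1 / 2))
  have hcover : (Set.univ : Set Ω) ⊆ T ∪ ⋃ z ∈ univ.filter (· ∈ A), {ω | Z ω = z} := by
    intro ω _
    by_cases hω : Z ω ∈ A
    · right
      simp [hω]
    · exact Or.inl (hT ω hω)
  have h1 := measureReal_mono (μ := P) hcover
  have h2 := measureReal_union_le (μ := P) T (⋃ z ∈ univ.filter (· ∈ A), {ω | Z ω = z})
  have h3 := measureReal_biUnion_finset_le (μ := P) (univ.filter (· ∈ A)) fun z => {ω | Z ω = z}
  rw [sum_congr rfl fun z _ => h.measureReal_correctness_eq z, sum_filter] at h3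
  have h4 : ∑ z, (if z ∈ A then matrixWeight (fun i => 1 - effAbility (p i)) z else 0) =
      matrixProb (fun i => 1 - effAbility (p i)) A := by
    unfold matrixProb
    refine sum_congr rfl fun z _ => ?_
    rw [Set.indicator_apply]
  rw [probReal_univ] at h1
  linarith

end Main

/-! ### The failure probabilities -/

/-- The event, with failure probability `O(1 / m)`, on which the label error has the rate of the
collective wisdom. -/
def GoodMatrix {n m : ℕ} (q σ : Fin n → ℝ) (K : ℝ) (z : Fin n → Fin m → Bool) : Prop :=
  SpreadDeviations q z ∧ RatesClose q z ∧
    ∑ i, ∑ j, σ i * errDev (q i) (z i j) ≤ 3 / 2 * √(n * m * log m) ∧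
    avgErrFactor (1 / 300) q z ≤ exp (-(K / 8) - (1121 + 35 * (1 / 300) * K))

theorem matrixProb_not_goodMatrix_le {n m : ℕ} (hn : 0 < n) (hm : 0 < m) (hnm : n ≤ m)
    {q σ : Fin n → ℝ} (hq : ∀ i, q i ∈ Set.Icc (0 : ℝ) (1 / 2)) (hσ : ∀ i, |σ i| = 1)
    {K : ℝ} (hKdef : K = ∑ i, (1 - 2 * q i) ^ 2) (hK : 2 * 10 ^ 10 ≤ K)
    (hKlog : log (m : ℝ) + log n ≤ K / 4) :
    matrixProb q {z : Fin n → Fin m → Bool | ¬ GoodMatrix q σ K z} ≤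
      (3 + 8 * 160000 ^ 2 + exp 1121) / m := by
  have hq' : ∀ i, q i ∈ Set.Icc (0 : ℝ) 1 := fun i => ⟨(hq i).1, by linarith [(hq i).2]⟩
  have hsub : {z : Fin n → Fin m → Bool | ¬ GoodMatrix q σ K z} ⊆
      {z | ¬ SpreadDeviations q z} ∪ ({z | ¬ RatesClose q z} ∪
      ({z | 3 / 2 * √(n * m * log m) < ∑ i, ∑ j, σ i * errDev (q i) (z i j)} ∪
      {z | exp (-(K / 8) - (1121 + 35 * (1 / 300) * K)) < avgErrFactor (1 / 300) q z})) := by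
    intro z hz
    simp only [GoodMatrix, Set.mem_ofPred_eq, Set.mem_union, not_and_or, not_le] at hz ⊢
    exact hz
  refine (matrixProb_mono hq' hsub).trans ?_
  have h1 := matrixProb_not_spreadDeviations_le hm hnm hq'
  have h2 := matrixProb_not_ratesClose_le hm hnm hq'
  have h3 := matrixProb_aggregate_le hn hm hq' (σ := σ) fun i => by rw [← sq_abs, hσ i, one_pow]
  have h4 := matrixProb_avgErrFactor_const_le hm hq hKdef hK hKlog
  refine (matrixProb_union_le hq' _ _).trans ?_
  refine (add_le_add_right ((matrixProb_union_le hq' _ _).trans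
    (add_le_add_right (matrixProb_union_le hq' _ _) _)) _).trans ?_
  have e : (3 + 8 * 160000 ^ 2 + exp 1121) / (m : ℝ) =
      2 / m + (8 * 160000 ^ 2 / m + (1 / m + exp 1121 / m)) := by ring
  rw [e]
  exact add_le_add h1 (add_le_add h2 (add_le_add h3 h4))

theorem klBernoulli_one_sub (μ : ℝ) : klBernoulli μ (1 - μ) =
    (1 - 2 * (1 - μ)) * log ((1 - (1 - μ)) / (1 - μ)) := by
  have e : log ((1 - μ) / μ) = -log (μ / (1 - μ)) := by rw [← log_inv, inv_div]
  rw [klBernoulli, sub_sub_cancel, e]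
  ring

/-- Failure probability of the refined bound, with the a priori bound `exp (-K / 8)` for the label
error, when the divergence `d` of the average error probability `a` exceeds three times `K / n`. -/
theorem matrixProb_divergence_le {n m : ℕ} (hn : 0 < n) (hm : 0 < m)
    {q : Fin n → ℝ} (hq : ∀ i, q i ∈ Set.Icc (0 : ℝ) (1 / 2))
    {K : ℝ} (hKdef : K = ∑ i, (1 - 2 * q i) ^ 2) (hK : 2 * 10 ^ 10 ≤ K)
    (hKlog : log (m : ℝ) + log n ≤ K / 4) {a d : ℝ} (ha : ∑ i, q i = n * a) (ha0 : 0 < a)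
    (hd : d = (1 - 2 * a) * log ((1 - a) / a)) (hKd : 3 * K < n * d) (hlog : log (4 / a) < K) :
    matrixProb q {z : Fin n → Fin m → Bool | exp (-(n * d / 24) -
      (1121 + 35 * exp (-K / 8) * K)) < avgErrFactor (exp (-K / 8)) q z} ≤ exp 1401 / m := by
  have hm' : (0 : ℝ) < m := by positivity
  have hn' : (0 : ℝ) < n := by positivity
  have hq' : ∀ i, q i ∈ Set.Icc (0 : ℝ) 1 := fun i => ⟨(hq i).1, by linarith [(hq i).2]⟩
  have hKn : K ≤ n := by
    calc K ≤ ∑ i : Fin n, (1 : ℝ) := by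
          rw [hKdef]
          exact sum_le_sum fun i _ => by nlinarith [(hq i).1, (hq i).2]
      _ = n := by simp
  have ha1 : a ≤ 1 / 2 := by
    have : ∑ i, q i ≤ ∑ i : Fin n, (1 / 2 : ℝ) := sum_le_sum fun i _ => (hq i).2
    rw [ha] at this
    simp only [sum_const, card_univ, Fintype.card_fin, nsmul_eq_mul] at this
    exact le_of_mul_le_mul_left this hn'
  have hcs : n * (1 - 2 * a) ^ 2 ≤ K := by
    have h := sq_sum_le_card_mul_sum_sq (s := (univ : Finset (Fin n))) (f := fun i => 1 - 2 * q i)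
    rw [← hKdef, sum_sub_distrib, ← mul_sum, ha] at h
    simp only [sum_const, card_univ, Fintype.card_fin, nsmul_eq_mul, mul_one] at h
    have e : ((n : ℝ) - 2 * (n * a)) ^ 2 = n * (n * (1 - 2 * a) ^ 2) := by ring
    rw [e] at h
    exact le_of_mul_le_mul_left h hn'
  have hexp := exponent_le hn' ha0 ha1 hd hKn hKd hcs hlog (by linarith)
  have hρ0 : 0 < exp (-K / 8) := exp_pos _
  have hprod := prod_meanErrFactor_le hq hρ0.le (add_pos ha0 hρ0) (by rw [ha]; ring)
  refine (matrixProb_avgErrFactor_le hm hq' hρ0.le hprod).trans ?_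
  have hn0 : 0 ≤ log (n : ℝ) := log_natCast_nonneg n
  have e : exp 1401 / (m : ℝ) = exp (1401 - log m) := by rw [exp_sub, exp_log hm']
  rw [e]
  apply exp_le_exp.2
  have hρK : exp (-K / 8) * K ≤ 8 := by
    have h1 := add_one_le_exp (K / 8)
    have h2 : exp (-K / 8) * exp (K / 8) = 1 := by rw [← exp_add, neg_div]; simp
    nlinarith
  linarith

end DawidSkene

open DawidSkene in
theorem theorem3p2 :
    ∃ C : ℝ, 0 < C ∧ ∃ N : ℕ, ∀ n m : ℕ, N ≤ n → N ≤ m → n ≤ m → (m : ℝ) ≤ Real.exp n →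
      ∀ (Ω : Type*) [MeasurableSpace Ω] (P : MeasureTheory.Measure Ω)
        [MeasureTheory.IsProbabilityMeasure P]
        (pStar : Fin n → ℝ) (yStar : Fin m → Bool) (X : Fin n → Fin m → Ω → Bool),
        (∀ i, pStar i ∈ Set.Icc (0 : ℝ) 1) →
        IsOneCoinModel P pStar yStar X →
        1 / 2 + 2 * √(Real.log m / (n * m)) < (∑ i, pStar i) / n →
        max (4 * (Real.log m + Real.log n)) (12 * Real.log n) / n ≤ nuBar pStar →
        (1 - C / m ≤ P.real {ω | ∀ yHat : Fin m → ℝ,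
            IsConstrainedEstimator (fun i j => X i j ω) yHat →
              labelingError yHat yStar ≤ Real.exp (-(1 / 8) * n * nuBar pStar)}) ∧
        (muBar pStar < 1 →
          1 / n * Real.log (4 / (1 - muBar pStar)) < nuBar pStar →
          1 - C / m ≤ P.real {ω | ∀ yHat : Fin m → ℝ,
            IsConstrainedEstimator (fun i j => X i j ω) yHat →
              labelingError yHat yStar ≤ Real.exp (-(1 / 8) * n *
                max (nuBar pStar)
                  (1 / 3 * klBernoulli (muBar pStar) (1 - muBar pStar)))}) := by
  obtain ⟨N, hN⟩ := exists_nat_ge (Real.exp (2 * 10 ^ 10))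
  refine ⟨3 + 8 * 160000 ^ 2 + Real.exp 1121 + Real.exp 1401, by positivity, N, ?_⟩
  intro n m hNn hNm hnm _ Ω _ P _ p y X hp hX hmean hν
  have hlogge : ∀ k : ℕ, N ≤ k → (0 : ℝ) < k ∧ 2 * 10 ^ 10 ≤ Real.log k := by
    intro k hk
    have h1 : Real.exp (2 * 10 ^ 10) ≤ k := hN.trans (by exact_mod_cast hk)
    have h2 : (0 : ℝ) < k := (Real.exp_pos _).trans_le h1
    exact ⟨h2, (Real.le_log_iff_exp_le h2).2 h1⟩
  obtain ⟨hn', hlogn⟩ := hlogge n hNn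
  obtain ⟨hm', hlogm⟩ := hlogge m hNm
  have hn : 0 < n := by exact_mod_cast hn'
  have hm : 0 < m := by exact_mod_cast hm'
  set q : Fin n → ℝ := fun i => 1 - effAbility (p i) with hqdef
  have hq : ∀ i, q i ∈ Set.Icc (0 : ℝ) (1 / 2) := fun i => effAbility_mem (hp i)
  set f : Fin n → Bool := fun i => decide (p i < 1 / 2) with hf
  set σ : Fin n → ℝ := fun i => if f i then -1 else 1 with hσdef
  have hσ : ∀ i, |σ i| = 1 := fun i => by simp only [hσdef]; split_ifs <;> simp
  set K := ∑ i, (1 - 2 * q i) ^ 2 with hKdef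
  have hKν : n * nuBar p = K := by
    rw [nuBar, mul_div_cancel₀ _ hn'.ne', hKdef]
    refine Finset.sum_congr rfl fun i _ => ?_
    simp only [hqdef]; ring
  rw [div_le_iff₀ hn', mul_comm (nuBar p), hKν, max_le_iff] at hν
  have hK : 2 * 10 ^ 10 ≤ K := by linarith [hν.2]
  have hKlog : Real.log m + Real.log n ≤ K / 4 := by linarith [hν.1]
  have hbias : 4 * (n * √(Real.log m / (n * m))) ≤ ∑ i, σ i * (1 - 2 * q i) := by
    have e : ∀ i, σ i * (1 - 2 * q i) = 2 * p i - 1 := by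
      intro i
      by_cases h : p i < 1 / 2
      · have h1 : f i = true := decide_eq_true h
        have h2 : effAbility (p i) = 1 - p i := if_neg (not_le.2 h)
        simp only [hσdef, hqdef, h1, h2, if_true]; ring
      · have h1 : f i = false := decide_eq_false h
        have h2 : effAbility (p i) = p i := if_pos (not_lt.1 h)
        simp only [hσdef, hqdef, h1, h2, if_false, Bool.false_eq_true]; ring
    rw [lt_div_iff₀ hn'] at hmean
    rw [Finset.sum_congr rfl fun i _ => e i, Finset.sum_sub_distrib, ← Finset.mul_sum]
    simp only [Finset.sum_const, Finset.card_univ, Fintype.card_fin, nsmul_eq_mul, mul_one]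
    nlinarith
  have hgood := matrixProb_not_goodMatrix_le hn hm hnm hq hσ hKdef hK hKlog
  have hC : (3 + 8 * 160000 ^ 2 + Real.exp 1121) / (m : ℝ) + Real.exp 1401 / m =
      (3 + 8 * 160000 ^ 2 + Real.exp 1121 + Real.exp 1401) / m := by ring
  have hest : ∀ ω, GoodMatrix q σ K (correctness (fun i j => X i j ω) y f) → ∀ yHat : Fin m → ℝ,
      IsConstrainedEstimator (fun i j => X i j ω) yHat →
      labelingError yHat y ≤ Real.exp (-(K / 8)) := by
    rintro ω ⟨h1, h2, h3, h4⟩ u hu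
    obtain ⟨hmax, herr, hsign⟩ := hu.correctness hn hm y f
    rw [herr]
    exact hmax.mean_le_exp hn hm hq hσ hKdef hK (by linarith) hKlog hbias h1 h2 h3 h4 hsign
  have hclaim : 1 - (3 + 8 * 160000 ^ 2 + Real.exp 1121 + Real.exp 1401) / (m : ℝ) ≤
      P.real {ω | ∀ yHat : Fin m → ℝ, IsConstrainedEstimator (fun i j => X i j ω) yHat →
        labelingError yHat y ≤ Real.exp (-(1 / 8) * n * nuBar p)} := by
    refine hX.one_sub_le_measureReal (A := {z | ¬ GoodMatrix q σ K z}) (hgood.trans ?_)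
      fun ω hω => ?_
    · rw [← hC]; exact le_add_of_nonneg_right (by positivity)
    · have e : -(1 / 8) * n * nuBar p = -(K / 8) := by rw [← hKν]; ring
      rw [Set.mem_ofPred_eq, e]
      exact hest ω (not_not.1 hω)
  refine ⟨hclaim, fun hμ hlog => ?_⟩
  rcases le_or_gt (1 / 3 * klBernoulli (muBar p) (1 - muBar p)) (nuBar p) with hle | hlt
  · rwa [max_eq_left hle]
  -- the divergence dominates; the rate of the collective wisdom serves as the a priori bound
  rw [max_eq_right hlt.le]
  set d := klBernoulli (muBar p) (1 - muBar p) with hd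
  set a := 1 - muBar p with ha
  have ha0 : 0 < a := by linarith
  have hda : d = (1 - 2 * a) * Real.log ((1 - a) / a) := klBernoulli_one_sub _
  have hsum : ∑ i, q i = n * a := by
    simp only [hqdef, ha, muBar, Finset.sum_sub_distrib, Finset.sum_const, Finset.card_univ,
      Fintype.card_fin, nsmul_eq_mul, mul_one, mul_sub]
    rw [mul_div_cancel₀ _ hn'.ne']
  have hKd : 3 * K < n * d := by
    rw [← hKν]
    nlinarith
  have hlog' : Real.log (4 / a) < K := by
    rw [← hKν]
    have := mul_lt_mul_of_pos_left hlog hn'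
    rwa [← mul_assoc, mul_one_div_cancel hn'.ne', one_mul] at this
  have hdiv := matrixProb_divergence_le hn hm hq hKdef hK hKlog hsum ha0 hda hKd hlog'
  have hq' : ∀ i, q i ∈ Set.Icc (0 : ℝ) 1 := fun i => ⟨(hq i).1, by linarith [(hq i).2]⟩
  refine hX.one_sub_le_measureReal (A := {z | ¬ GoodMatrix q σ K z} ∪ {z | Real.exp (-(n * d / 24) -
      (1121 + 35 * Real.exp (-K / 8) * K)) < avgErrFactor (Real.exp (-K / 8)) q z})
    (((matrixProb_union_le hq' _ _).trans (add_le_add hgood hdiv)).trans_eq hC)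
    fun ω hω u hu => ?_
  rw [Set.mem_union, not_or] at hω
  have hg : GoodMatrix q σ K (correctness (fun i j => X i j ω) y f) := not_not.1 hω.1
  have havg : avgErrFactor (Real.exp (-K / 8)) q (correctness (fun i j => X i j ω) y f) ≤
      Real.exp (-(n * d / 24) - (1121 + 35 * Real.exp (-K / 8) * K)) := not_lt.1 hω.2
  have hfirst := hest ω hg u hu
  obtain ⟨hmax, herr, -⟩ := hu.correctness hn hm y f
  rw [herr] at hfirst ⊢
  rw [show -(K / 8) = -K / 8 by ring] at hfirst
  have hρ : Real.exp (-K / 8) ≤ 1 / 300 := by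
    rw [neg_div, Real.exp_neg, one_div]
    exact inv_anti₀ (by norm_num) (by linarith [Real.add_one_le_exp (K / 8)])
  refine (hmax.mean_le hm (Real.exp_pos _) hρ hq hg.1 hg.2.1 hfirst).trans ?_
  refine (mul_le_mul_of_nonneg_left havg (Real.exp_pos _).le).trans_eq ?_
  rw [← Real.exp_add]
  congr 1
  rw [← hKdef]; ring
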